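/- Let $n\ge 1$ and let $\mathbb S^n\subset\mathbb R^{n+1}$ be the unit sphere with its surface measure $d\xi$. Put $C_n=\frac4n\,\frac{\pi^{n/2}}{\Gamma(n/2)}$, $$\mathcal D=\Big\{v\in L^2(\mathbb S^n;\mathbb R):\ \iint_{\mathbb S^n\times\mathbb S^n}\frac{|v(\xi)-v(\eta)|^2}{|\xi-\eta|^n}\,d\xi\,d\eta<\infty\Big\},$$ and, for $u,v\in\mathcal D$, $$\mathcal E[u,v]=\frac12\iint_{\mathbb S^n\times\mathbb S^n}\frac{(u(\xi)-u(\eta))(v(\xi)-v(\eta))}{|\xi-\eta|^n}\,d\xi\,d\eta .$$ Let $\Phi$ be a conformal map of $\mathbb S^n$, that is, a smooth diffeomorphism of $\mathbb S^n$ whose differential multiplies, at each point, the round metric by a positive factor; for $n=1$, where this condition is empty, $\Phi$ is in addition required to be a Möbius transformation of the circle (to preserve absolute cross ratios). Write $J_\Phi=|\det D\Phi|$ and, for a function $u$ on $\mathbb S^n$, $u_\Phi=J_\Phi^{1/2}\,(u\circ\Phi)$. Let $u,v\in\mathcal D$. Then: 1. $u_\Phi,v_\Phi\in\mathcal D$.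 2. $uv\ln J_{\Phi^{-1}}^{-1/2}$ is integrable, where $J_{\Phi^{-1}}^{-1/2}=1/\sqrt{J_{\Phi^{-1}}}$, and $$\mathcal E[u_\Phi,v_\Phi]=\mathcal E[u,v]+C_n\int_{\mathbb S^n}u\,v\,\ln J_{\Phi^{-1}}^{-1/2}\,d\xi .$$ 3. In the weak sense, $H(u_\Phi)=(Hu)_\Phi+C_n\,u_\Phi\ln J_\Phi^{1/2}$. Here $Hu$ is the functional $\langle Hu,\varphi\rangle=\mathcal E[\varphi,u]$ on $\mathcal D$, and the pullback of a functional $L$ on $\mathcal D$ is $\langle L_\Phi,\varphi\rangle=\langle L,\varphi_{\Phi^{-1}}\rangle$; so the claim is that, for every $\varphi\in\mathcal D$, the function $\varphi\,u_\Phi\ln J_\Phi^{1/2}$ is integrable and $$\mathcal E[\varphi,u_\Phi]=\mathcal E[\varphi_{\Phi^{-1}},u]+C_n\int_{\mathbb S^n}\varphi\,u_\Phi\ln J_\Phi^{1/2}\,d\xi .$$ 4. If $u$ is a weak solution of $$\mathrm{P.V.}\int_{\mathbb S^n}\frac{u(\omega)-u(\eta)}{|\omega-\eta|^n}\,d\eta=C_n\,u(\omega)\ln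 u(\omega)\quad\text{in }\mathbb S^n,$$ then so is $u_\Phi$. Here a weak solution is a function $u\in\mathcal D$ with $u\ge0$ almost everywhere such that, for every $\varphi\in\mathcal D$, the function $\varphi\,u\ln u$ is integrable (with $0\ln0=0$) and $\mathcal E[\varphi,u]=C_n\int_{\mathbb S^n}\varphi\,u\ln u\,d\omega$. -/

import Mathlib

open MeasureTheory
open scoped Manifold ContDiff

noncomputable section

namespace ConformalLog

/-- The Euclidean space `ℝ^{n+1}`. -/
abbrev Ambient (n : ℕ) : Type := EuclideanSpace ℝ (Fin (n + 1))

/-- The unit sphere `𝕊^n` in `ℝ^{n+1}`, with Mathlib's smooth structure. -/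
abbrev Sph (n : ℕ) : Type := Metric.sphere (0 : Ambient n) 1

/-- The surface measure on `𝕊^n` (total mass `(n+1)|B^{n+1}| = 2π^{(n+1)/2}/Γ((n+1)/2)`). -/
def surf (n : ℕ) : Measure (Sph n) := (volume : Measure (Ambient n)).toSphere

/-- The constant `C_n = (4/n) π^{n/2} / Γ(n/2)`. -/
def Cn (n : ℕ) : ℝ := 4 / (n : ℝ) * (Real.pi ^ ((n : ℝ) / 2) / Real.Gamma ((n : ℝ) / 2))

/-- The chordal distance `|ξ - η|` in `ℝ^{n+1}`. -/
def chord {n : ℕ} (ξ η : Sph n) : ℝ := ‖(ξ : Ambient n) - (η : Ambient n)‖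

/-- The energy space `𝒟` of real functions in `L²(𝕊^n)` with finite double integral.
(The diagonal, where the quotient is `0 / 0`, is a null set for `n ≥ 1`.) -/
def energySpace (n : ℕ) : Set (Sph n → ℝ) :=
  {v | MemLp v 2 (surf n) ∧
    ∫⁻ p : Sph n × Sph n, ENNReal.ofReal ((v p.1 - v p.2) ^ 2 / chord p.1 p.2 ^ n)
      ∂((surf n).prod (surf n)) < ⊤}

/-- The bilinear form `ℰ[u, v]`. -/
def energy {n : ℕ} (u v : Sph n → ℝ) : ℝ :=
  1 / 2 * ∫ p : Sph n × Sph n, (u p.1 - u p.2) * (v p.1 - v p.2) / chord p.1 p.2 ^ n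
    ∂((surf n).prod (surf n))

/-- The differential at `x` of a map `𝕊^n → 𝕊^n`, followed by the inclusion of the tangent space of
the target into `ℝ^{n+1}`. (Mathlib's `TangentSpace (𝓡 n) x` is `EuclideanSpace ℝ (Fin n)`.) -/
def tangentMap {n : ℕ} (Φ : Sph n → Sph n) (x : Sph n) :
    EuclideanSpace ℝ (Fin n) →L[ℝ] Ambient n :=
  mvfderiv (𝓡 n) (fun y => (Φ y : Ambient n)) x

/-- The pullback under `Φ` of the round metric (the one induced by the embedding of `𝕊^n` into
`ℝ^{n+1}`): a bilinear form on the tangent space at `x`. For `Φ = id` it is the round metric. -/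
def pullbackMetric {n : ℕ} (Φ : Sph n → Sph n) (x : Sph n) (a b : EuclideanSpace ℝ (Fin n)) : ℝ :=
  inner ℝ (tangentMap Φ x a) (tangentMap Φ x b)

/-- The matrix of the pulled back metric in the coordinate basis of the tangent space at `x`. -/
def metricMatrix {n : ℕ} (Φ : Sph n → Sph n) (x : Sph n) : Matrix (Fin n) (Fin n) ℝ :=
  Matrix.of fun i j => pullbackMetric Φ x
    (EuclideanSpace.single i 1) (EuclideanSpace.single j 1)

/-- The Jacobian `J_Φ(x) = |det DΦ(x)|`, the determinant being taken in orthonormal bases of the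
tangent spaces at `x` and `Φ(x)`; in the coordinate basis this is `√(det Φ^*g / det g)`. -/
def jac {n : ℕ} (Φ : Sph n → Sph n) (x : Sph n) : ℝ :=
  √((metricMatrix Φ x).det / (metricMatrix id x).det)

/-- `Φ` is a conformal map of `𝕊^n`: at each point its differential multiplies the round metric by a
positive factor. On the circle this says nothing, every diffeomorphism satisfies it; conformal
maps of the circle are, as usual, the Möbius transformations, that is, the maps which preserve
the absolute cross ratios (written below without denominators). -/
structure IsConformal {n : ℕ} (Φ : Sph n ≃ₘ⟮𝓡 n, 𝓡 n⟯ Sph n) : Prop where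
  conformal : ∀ x : Sph n, ∃ c : ℝ, 0 < c ∧ ∀ a b : EuclideanSpace ℝ (Fin n),
    pullbackMetric Φ x a b = c * pullbackMetric id x a b
  moebius : n = 1 → ∀ p q r s : Sph n,
    (chord (Φ p) (Φ q) * chord (Φ r) (Φ s)) * (chord p r * chord q s) =
      (chord p q * chord r s) * (chord (Φ p) (Φ r) * chord (Φ q) (Φ s))

/-- The pullback `u_Φ = J_Φ^{1/2} (u ∘ Φ)` of a function. -/
def pullback {n : ℕ} (Φ : Sph n → Sph n) (u : Sph n → ℝ) : Sph n → ℝ :=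
  fun x => √(jac Φ x) * u (Φ x)

/-- `H u` in the weak sense: the functional `φ ↦ ⟨H u, φ⟩ = ℰ[φ, u]`. -/
def weakH {n : ℕ} (u : Sph n → ℝ) : (Sph n → ℝ) → ℝ := fun φ => energy φ u

/-- A function, seen as the functional `φ ↦ ∫ φ f`. -/
def weakFun {n : ℕ} (f : Sph n → ℝ) : (Sph n → ℝ) → ℝ := fun φ => ∫ x, φ x * f x ∂(surf n)

/-- The pullback of a functional, `⟨L_Φ, φ⟩ = ⟨L, φ_{Φ⁻¹}⟩`. It extends the pullback of functions,
as `∫ φ f_Φ = ∫ φ_{Φ⁻¹} f`. -/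
def pullbackWeak {n : ℕ} (Φ : Sph n ≃ₘ⟮𝓡 n, 𝓡 n⟯ Sph n) (L : (Sph n → ℝ) → ℝ) :
    (Sph n → ℝ) → ℝ :=
  fun φ => L (pullback Φ.symm φ)

/-- `u` is a (nonnegative) weak solution of `P.V. ∫ (u(ω) - u(η)) / |ω - η|^n dη = C_n u ln u`.
The integral on the right side of the weak formulation is required to exist. -/
structure IsWeakSolution {n : ℕ} (u : Sph n → ℝ) : Prop where
  mem : u ∈ energySpace n
  nonneg : ∀ᵐ x ∂(surf n), 0 ≤ u x
  integrable : ∀ φ ∈ energySpace n, Integrable (fun x => φ x * (u x * Real.log (u x))) (surf n)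
  eq : ∀ φ ∈ energySpace n,
    energy φ u = Cn n * ∫ x, φ x * (u x * Real.log (u x)) ∂(surf n)

end ConformalLog

end

open MeasureTheory
open scoped Manifold ContDiff

noncomputable section

namespace ConformalLog

open Module Filter Topology Metric

variable {n : ℕ}

/-! The kernel `|ξ - η|^(-n)` is just not integrable, so the energy cannot be split into a diagonal
and an off-diagonal term. Replace it by the Riesz kernel `|ξ - η|^(2ε - n)`. Its mass `kerMass n ε`
does not depend on the point, and `energyReg_eq` gives `ℰ_ε[u, v] = kerMass n ε ∫ uv - ∬ u(ξ) v(η)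
|ξ - η|^(2ε - n)`.

A conformal map satisfies `|Φp - Φq|² = s(p) s(q) |p - q|²` with `s` its scaling factor and `J_Φ =
s^n` (`IsConformal.exists_isMoebiusScale`). Hence the `L²` term is invariant under `u ↦ u_Φ`, and
the double integral changes only by the weight `(r(ξ) r(η))^(-ε)`, `r = s ∘ Φ⁻¹`. The defect `1 -
(r(ξ) r(η))^(-ε)` is about `ε log (r(ξ) r(η))`, while `ε |ξ - η|^(2ε - n)` tends to `n C_n / 4`
times the delta measure on the diagonal (`tendsto_integral_ker`). In the limit the logarithmic term
`C_n ∫ uv log r^(n/2)` remains (`tendsto_integral_mul_anomaly`).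

The regularized identity needs only `u, v ∈ L²`, so Fatou's lemma gives `u_Φ ∈ 𝒟`
(`mem_energySpace_of_tendsto`), and letting `ε → 0` gives the formula for `ℰ`. The weak statement is
this formula for the pair `φ_{Φ⁻¹}, u`. In the nonlinear equation, the extra term is the one
produced by the logarithm of the product `J_Φ^(1/2) (u ∘ Φ)`.

The distance law is Liouville's theorem for `n ≥ 2`: in stereographic coordinates sending `-x` and
`Φ(-x)` to infinity, `Φ` is an entire conformal map with scaling factor bounded below, hence a
similarity. For `n = 1` it is the infinitesimal form of the cross ratio hypothesis. -/

/-- The model space `ℝ^n`. -/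
abbrev Model (n : ℕ) : Type := EuclideanSpace ℝ (Fin n)

/-! ### Stereographic coordinates on the sphere -/

/-- The inverse of the stereographic projection from `-x`, which sends `0` to `x`. -/
def par (x : Sph n) (w : Model n) : Sph n := (chartAt (Model n) x).symm w

/-- The conformal factor of the inverse stereographic projection. -/
def kap (w : Model n) : ℝ := 4 / (‖w‖ ^ 2 + 4)

lemma kap_pos (w : Model n) : 0 < kap w := by unfold kap; positivity

lemma continuous_kap : Continuous (kap (n := n)) := by
  unfold kap
  exact continuous_const.div (by fun_prop) fun w => by positivity

/-- Mathlib's chart at `x` projects from `-x`. Here `U` identifies the model space with the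
hyperplane orthogonal to `x`; the metric identities below use nothing else about the chart. -/
lemma par_coe (x : Sph n) : ∃ U : Model n →ₗᵢ[ℝ] Ambient n,
    (∀ w, inner ℝ (U w) (x : Ambient n) = 0) ∧
    ∀ w, (par x w : Ambient n) =
      (‖w‖ ^ 2 + 4)⁻¹ • ((4 : ℝ) • U w + (4 - ‖w‖ ^ 2) • (x : Ambient n)) := by
  have := Fact.mk (@finrank_euclideanSpace_fin ℝ _ (n + 1))
  let U := (OrthonormalBasis.fromOrthogonalSpanSingleton (𝕜 := ℝ) n
    (ne_zero_of_mem_unit_sphere (-x))).repr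
  refine ⟨(Submodule.subtypeₗᵢ _).comp U.symm.toLinearIsometry, fun w => ?_, fun w => ?_⟩
  · have := Submodule.mem_orthogonal_singleton_iff_inner_left.mp (U.symm w).2
    have e : ((-x : Sph n) : Ambient n) = -(x : Ambient n) := rfl
    change inner ℝ ((U.symm w : _) : Ambient n) (x : Ambient n) = 0
    generalize ((U.symm w : _) : Ambient n) = z at this ⊢
    rwa [e, inner_neg_right, neg_eq_zero] at this
  · have h := stereographic'_symm_apply (n := n) (-x) w
    have hU : ‖((U.symm w : (Submodule.span ℝ {((-x : Sph n) : Ambient n)})ᗮ) : Ambient n)‖ = ‖w‖ := by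
      rw [← Submodule.coe_norm, LinearIsometryEquiv.norm_map]
    change ((stereographic' n (-x)).symm w : Ambient n) = _
    rw [h]
    change (‖((U.symm w : _) : Ambient n)‖ ^ 2 + 4)⁻¹ • (4 : ℝ) • ((U.symm w : _) : Ambient n) +
      (‖((U.symm w : _) : Ambient n)‖ ^ 2 + 4)⁻¹ • (‖((U.symm w : _) : Ambient n)‖ ^ 2 - 4) •
        (-x : Sph n).val = _
    rw [hU]
    simp only [LinearIsometry.coe_comp, Function.comp_apply, Submodule.coe_subtypeₗᵢ,
      LinearIsometryEquiv.coe_toLinearIsometry, Submodule.subtype_apply]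
    have : ((-x : Sph n) : Ambient n) = -(x : Ambient n) := rfl
    generalize ((U.symm w : _) : Ambient n) = z
    rw [this]
    module

/-- The analogue for the chart of the distance law `IsMoebiusScale` of a conformal map. Both image
points are unit vectors, so only their inner product has to be computed. -/
lemma chord_par (x : Sph n) (w w' : Model n) :
    chord (par x w) (par x w') ^ 2 = kap w * kap w' * ‖w - w'‖ ^ 2 := by
  obtain ⟨U, hU, h⟩ := par_coe x
  have hx : ‖(x : Ambient n)‖ = 1 := by simp
  have e1 : ∀ w w' : Model n, inner ℝ (par x w : Ambient n) (par x w' : Ambient n) =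
      (‖w‖ ^ 2 + 4)⁻¹ * (‖w'‖ ^ 2 + 4)⁻¹ *
        (16 * inner ℝ w w' + (4 - ‖w‖ ^ 2) * (4 - ‖w'‖ ^ 2)) := by
    intro w w'
    have hU' : ∀ w, inner ℝ (x : Ambient n) (U w) = 0 := fun w => by
      rw [real_inner_comm]; exact hU w
    rw [h, h]
    simp only [inner_smul_left, inner_smul_right, inner_add_left, inner_add_right, hU, hU',
      LinearIsometry.inner_map_map, real_inner_self_eq_norm_sq, hx]
    simp
    ring
  have h1 : ‖(par x w : Ambient n)‖ = 1 := by simp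
  have h2 : ‖(par x w' : Ambient n)‖ = 1 := by simp
  unfold chord kap
  rw [norm_sub_sq_real, norm_sub_sq_real, h1, h2, e1]
  have : ‖w‖ ^ 2 + 4 ≠ 0 := by positivity
  have : ‖w'‖ ^ 2 + 4 ≠ 0 := by positivity
  field_simp
  ring

/-- This measures the approach to the pole at infinity, and later bounds the scaling factor of
`chartMap` there. -/
lemma chord_par_neg (x : Sph n) (w : Model n) : chord (par x w) (-x) ^ 2 = 4 * kap w := by
  obtain ⟨U, hU, h⟩ := par_coe x
  have hx : ‖(x : Ambient n)‖ = 1 := by simp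
  have h1 : ‖(par x w : Ambient n)‖ = 1 := by simp
  have : ((-x : Sph n) : Ambient n) = -(x : Ambient n) := rfl
  unfold chord kap
  rw [norm_sub_sq_real, this, norm_neg, h1, hx, h, inner_neg_right]
  simp only [inner_smul_left, inner_add_left, hU, real_inner_self_eq_norm_sq, hx]
  have : ‖w‖ ^ 2 + 4 ≠ 0 := by positivity
  simp
  field_simp
  ring

@[simp] lemma par_zero (x : Sph n) : par x 0 = x := by
  obtain ⟨U, hU, h⟩ := par_coe x
  apply Subtype.ext
  rw [h]
  simp

lemma chart_target (x : Sph n) : (chartAt (Model n) x).target = Set.univ :=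
  have := Fact.mk (@finrank_euclideanSpace_fin ℝ _ (n + 1))
  stereographic'_target _

lemma chart_source (x : Sph n) : (chartAt (Model n) x).source = {-x}ᶜ :=
  have := Fact.mk (@finrank_euclideanSpace_fin ℝ _ (n + 1))
  stereographic'_source _

lemma chart_par (x : Sph n) (w : Model n) : chartAt (Model n) x (par x w) = w :=
  (chartAt (Model n) x).right_inv (by rw [chart_target]; trivial)

lemma par_chart (x : Sph n) {y : Sph n} (hy : y ≠ -x) : par x (chartAt (Model n) x y) = y :=
  (chartAt (Model n) x).left_inv (by rw [chart_source]; exact hy)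

lemma par_ne_neg (x : Sph n) (w : Model n) : par x w ≠ -x := by
  have := (chartAt (Model n) x).map_target (x := w) (by rw [chart_target]; trivial)
  rw [chart_source] at this
  exact this

lemma chart_self (x : Sph n) : chartAt (Model n) x x = 0 := by
  conv_lhs => rw [← par_zero x]
  simpa using chart_par x 0

lemma par_injective (x : Sph n) : Function.Injective (par x) :=
  Function.LeftInverse.injective (chart_par x)

lemma contMDiff_par (x : Sph n) : ContMDiff (𝓡 n) (𝓡 n) ∞ (par x) := by
  have h := contMDiffOn_chart_symm (I := 𝓡 n) (n := ∞) (x := x)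
  rw [chart_target, contMDiffOn_univ] at h
  exact h

lemma contMDiffOn_chart' (x : Sph n) :
    ContMDiffOn (𝓡 n) (𝓡 n) ∞ (chartAt (Model n) x) {-x}ᶜ := by
  have h := contMDiffOn_chart (I := 𝓡 n) (n := ∞) (x := x)
  rwa [chart_source] at h

lemma continuous_par (x : Sph n) : Continuous (par x) := (contMDiff_par x).continuous

lemma contDiff_comp_par {F : Type*} [NormedAddCommGroup F] [NormedSpace ℝ F] {g : Sph n → F}
    (hg : ContMDiff (𝓡 n) 𝓘(ℝ, F) ∞ g) (x : Sph n) : ContDiff ℝ ∞ (fun w => g (par x w)) := by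
  rw [← contMDiff_iff_contDiff]
  exact hg.comp (contMDiff_par x)

lemma contMDiff_coe_comp {Ψ : Sph n → Sph n} (hΨ : ContMDiff (𝓡 n) (𝓡 n) ∞ Ψ) :
    ContMDiff (𝓡 n) 𝓘(ℝ, Ambient n) ∞ (fun y => (Ψ y : Ambient n)) :=
  have := Fact.mk (@finrank_euclideanSpace_fin ℝ _ (n + 1))
  contMDiff_coe_sphere.comp hΨ

lemma tangentMap_eq {Ψ : Sph n → Sph n} (hΨ : ContMDiff (𝓡 n) (𝓡 n) ∞ Ψ) (x : Sph n) :
    tangentMap Ψ x = fderiv ℝ (fun w => (Ψ (par x w) : Ambient n)) 0 := by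
  have h := ((contMDiff_coe_comp hΨ) x).mdifferentiableAt (by simp)
  unfold tangentMap
  rw [h.mvfderiv]
  simp only [mfld_simps]
  rw [fderivWithin_univ, chart_self]
  rfl

lemma continuous_chord : Continuous fun p : Sph n × Sph n => chord p.1 p.2 := by
  unfold chord; fun_prop

lemma chord_comm (x y : Sph n) : chord x y = chord y x := norm_sub_rev _ _

lemma chord_nonneg (x y : Sph n) : 0 ≤ chord x y := norm_nonneg _

lemma chord_eq_dist (x y : Sph n) : chord x y = dist x y := by
  rw [Subtype.dist_eq, dist_eq_norm]; rfl

lemma chord_pos {x y : Sph n} (h : x ≠ y) : 0 < chord x y := by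
  rw [chord_eq_dist]; exact dist_pos.2 h

lemma chord_ne_zero {x y : Sph n} (h : x ≠ y) : chord x y ≠ 0 := (chord_pos h).ne'

lemma chord_le_two (x y : Sph n) : chord x y ≤ 2 := by
  unfold chord
  calc _ ≤ ‖(x : Ambient n)‖ + ‖(y : Ambient n)‖ := norm_sub_le _ _
    _ = 2 := by simp; norm_num

/-! ### Derivatives that multiply norms by a constant -/

/-- If difference quotients of norms converge to `μ`, the derivative multiplies norms by `μ`. -/
lemma norm_fderiv_of_tendsto {E F : Type*} [NormedAddCommGroup E] [NormedSpace ℝ E]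
    [NormedAddCommGroup F] [NormedSpace ℝ F] {g : E → F} {A : E →L[ℝ] F} {w : E} {μ : ℝ}
    (hA : HasFDerivAt g A w)
    (hμ : Tendsto (fun z => ‖g z - g w‖ / ‖z - w‖) (𝓝[≠] w) (𝓝 μ)) (h : E) :
    ‖A h‖ = μ * ‖h‖ := by
  rcases eq_or_ne h 0 with rfl | hh
  · simp
  have hc : Tendsto (fun t : ℝ => w + t • h) (𝓝[>] 0) (𝓝[≠] w) := by
    refine tendsto_nhdsWithin_iff.2 ⟨?_, ?_⟩
    · have : Tendsto (fun t : ℝ => w + t • h) (𝓝 0) (𝓝 (w + (0:ℝ) • h)) :=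
        Continuous.tendsto (by fun_prop) 0
      rw [zero_smul, add_zero] at this
      exact this.mono_left nhdsWithin_le_nhds
    · filter_upwards [self_mem_nhdsWithin] with t ht
      simpa [hh] using (ne_of_gt ht : t ≠ 0)
  have h1 := (hμ.comp hc).mul_const ‖h‖
  have h2 : Tendsto (fun t : ℝ => ‖t⁻¹ • (g (w + t • h) - g w)‖) (𝓝[>] 0) (𝓝 ‖A h‖) := by
    have := (hA.hasLineDerivAt h).tendsto_slope_zero_right
    exact this.norm
  refine tendsto_nhds_unique h2 (h1.congr' ?_)
  filter_upwards [self_mem_nhdsWithin] with t ht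
  have ht : 0 < t := ht
  have : ‖h‖ ≠ 0 := norm_ne_zero_iff.2 hh
  simp [norm_smul, abs_of_pos ht]
  field_simp

/-- Conversely, a derivative that multiplies norms by `μ` determines the difference quotients. -/
lemma tendsto_of_norm_fderiv {E F : Type*} [NormedAddCommGroup E] [NormedSpace ℝ E]
    [NormedAddCommGroup F] [NormedSpace ℝ F] {g : E → F} {A : E →L[ℝ] F} {w : E} {μ : ℝ}
    (hA : HasFDerivAt g A w) (hμ : ∀ h, ‖A h‖ = μ * ‖h‖) :
    Tendsto (fun z => ‖g z - g w‖ / ‖z - w‖) (𝓝[≠] w) (𝓝 μ) := by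
  have h1 : Tendsto (fun z => ‖g z - g w - A (z - w)‖ / ‖z - w‖) (𝓝[≠] w) (𝓝 0) := by
    have := hA.isLittleO.norm_norm.tendsto_div_nhds_zero
    exact this.mono_left nhdsWithin_le_nhds
  rw [tendsto_iff_dist_tendsto_zero]
  refine squeeze_zero' (Eventually.of_forall fun _ => dist_nonneg) ?_ h1
  filter_upwards [self_mem_nhdsWithin] with z hz
  have hz : 0 < ‖z - w‖ := norm_pos_iff.2 (sub_ne_zero.2 hz)
  rw [Real.dist_eq, le_div_iff₀ hz, ← abs_of_pos hz, ← abs_mul, abs_of_pos hz, sub_mul,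
    div_mul_cancel₀ _ hz.ne', ← hμ]
  exact abs_norm_sub_norm_le _ _

/-- Linear endomorphisms with the same norms have the same determinant up to sign. -/
lemma abs_det_eq_of_norm_eq {F : Type*} [NormedAddCommGroup F] [InnerProductSpace ℝ F]
    [FiniteDimensional ℝ F] (A : F →ₗ[ℝ] F) (B : F ≃ₗ[ℝ] F)
    (h : ∀ p, ‖A p‖ = ‖B p‖) : |LinearMap.det A| = |LinearMap.det (B : F →ₗ[ℝ] F)| := by
  let _ : MeasurableSpace F := borel F
  have : BorelSpace F := ⟨rfl⟩
  -- `A B⁻¹` is a linear isometry. It maps the unit ball onto itself, so comparing volumes shows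
  -- that its determinant is `±1`.
  let L : F →ₗᵢ[ℝ] F := ⟨A ∘ₗ (B.symm : F →ₗ[ℝ] F), fun p => by simp [h]⟩
  let L' : F ≃ₗᵢ[ℝ] F := L.toLinearIsometryEquiv rfl
  have h1 : volume (L.toLinearMap '' ball 0 1) = ENNReal.ofReal |LinearMap.det L.toLinearMap| *
    volume (ball (0 : F) 1) := Measure.addHaar_image_linearMap _ _ _
  have h2 : L.toLinearMap '' ball 0 1 = ball 0 1 := by
    have := L'.image_ball 0 1
    rw [map_zero] at this
    exact this
  rw [h2] at h1
  have h3 : |LinearMap.det L.toLinearMap| = 1 := by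
    have h0 : volume (ball (0 : F) 1) ≠ 0 := (measure_ball_pos _ _ one_pos).ne'
    have h4 : volume (ball (0 : F) 1) ≠ ⊤ := measure_ball_lt_top.ne
    have : ENNReal.ofReal |LinearMap.det L.toLinearMap| = 1 := by
      refine (ENNReal.mul_left_inj h0 h4).1 ?_
      rw [one_mul, ← h1]
    rwa [ENNReal.ofReal_eq_one] at this
  have h5 : A = L.toLinearMap ∘ₗ (B : F →ₗ[ℝ] F) := by
    ext p; simp [L]
  rw [h5, LinearMap.det_comp, abs_mul, h3, one_mul]

lemma abs_det_of_norm_eq_mul {F : Type*} [NormedAddCommGroup F] [InnerProductSpace ℝ F]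
    [FiniteDimensional ℝ F] (A : F →ₗ[ℝ] F) {μ : ℝ} (hμ : 0 < μ)
    (h : ∀ p, ‖A p‖ = μ * ‖p‖) : |LinearMap.det A| = μ ^ finrank ℝ F := by
  rw [abs_det_eq_of_norm_eq A (LinearEquiv.smulOfNeZero ℝ F μ hμ.ne')]
  · have : ((LinearEquiv.smulOfNeZero ℝ F μ hμ.ne' : F ≃ₗ[ℝ] F) : F →ₗ[ℝ] F) =
        μ • LinearMap.id := by ext; simp
    rw [this, LinearMap.det_smul, LinearMap.det_id, mul_one, abs_of_pos (pow_pos hμ _)]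
  · intro p; simp [h, norm_smul, abs_of_pos hμ]

lemma contDiff_par_coe (x : Sph n) : ContDiff ℝ ∞ (fun w => (par x w : Ambient n)) :=
  contDiff_comp_par (contMDiff_coe_comp contMDiff_id) x

lemma chord_par_eq (x : Sph n) (w w' : Model n) :
    chord (par x w) (par x w') = √(kap w) * √(kap w') * ‖w - w'‖ := by
  rw [← Real.sqrt_sq (chord_nonneg _ _), chord_par, Real.sqrt_mul (by
    have := kap_pos w; have := kap_pos w'; positivity), Real.sqrt_mul (kap_pos w).le,
    Real.sqrt_sq (norm_nonneg _)]

lemma tendsto_chord_par (x : Sph n) (w : Model n) :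
    Tendsto (fun z => chord (par x z) (par x w) / ‖z - w‖) (𝓝[≠] w) (𝓝 (kap w)) := by
  have h : Tendsto (fun z => √(kap z) * √(kap w)) (𝓝[≠] w) (𝓝 (kap w)) := by
    have : Continuous fun z : Model n => √(kap z) * √(kap w) :=
      (continuous_kap.sqrt).mul continuous_const
    have := (this.tendsto w).mono_left (nhdsWithin_le_nhds (s := {w}ᶜ))
    rwa [Real.mul_self_sqrt (kap_pos w).le] at this
  refine h.congr' ?_
  filter_upwards [self_mem_nhdsWithin] with z hz
  have hz : 0 < ‖z - w‖ := norm_pos_iff.2 (sub_ne_zero.2 hz)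
  rw [chord_par_eq]
  field_simp

lemma norm_fderiv_par (x : Sph n) (w h : Model n) :
    ‖fderiv ℝ (fun w => (par x w : Ambient n)) w h‖ = kap w * ‖h‖ :=
  norm_fderiv_of_tendsto ((contDiff_par_coe x).differentiable (by simp) w).hasFDerivAt
    (tendsto_chord_par x w) h

/-- Differentiate `‖par x w‖² = 1`: tangential directions are orthogonal to the radial one. -/
lemma inner_fderiv_par (x : Sph n) (w h : Model n) :
    inner ℝ (fderiv ℝ (fun w => (par x w : Ambient n)) w h) (par x w : Ambient n) = 0 := by
  have hd := ((contDiff_par_coe x).differentiable (by simp) w).hasFDerivAt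
  have h1 := hd.inner ℝ hd
  have h2 : (fun t => inner ℝ (par x t : Ambient n) (par x t : Ambient n)) = fun _ => (1:ℝ) := by
    ext t
    simp
  rw [h2] at h1
  have h3 := congrArg (fun L => L h) (h1.unique (hasFDerivAt_const (1:ℝ) w))
  simp [fderivInnerCLM_apply] at h3
  rw [real_inner_comm] at h3
  have h4 : inner ℝ (fderiv ℝ (fun w => (par x w : Ambient n)) w h) (par x w : Ambient n) +
    inner ℝ (fderiv ℝ (fun w => (par x w : Ambient n)) w h) (par x w : Ambient n) = 0 := h3
  linarith

/-! ### The surface measure in stereographic coordinates -/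

/-- `ℝ^n × ℝ` with the Euclidean norm. -/
abbrev ModelProd (n : ℕ) : Type := WithLp 2 (Model n × ℝ)

lemma finrank_modelProd : finrank ℝ (ModelProd n) = n + 1 := by
  rw [LinearEquiv.finrank_eq (WithLp.linearEquiv 2 ℝ (Model n × ℝ))]
  simp

/-- Some linear isometry from `ℝ^{n+1}` to `ℝ^n × ℝ`. -/
def splitAmbient (n : ℕ) : Ambient n ≃ₗᵢ[ℝ] ModelProd n :=
  (stdOrthonormalBasis ℝ (Ambient n)).equiv (stdOrthonormalBasis ℝ (ModelProd n))
    (finCongr (by rw [finrank_modelProd]; simp))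

/-- Polar coordinates combined with the stereographic projection. -/
def polarPar (x : Sph n) (p : ModelProd n) : ModelProd n :=
  splitAmbient n (p.snd • (par x p.fst : Ambient n))

/-- The tangential part of the derivative multiplies norms by `r · kap`, the radial part is
isometric, and the two are orthogonal. So the derivative has the same norms as a block diagonal map,
hence the same `|det|`. -/
lemma polarPar_hasFDerivAt (x : Sph n) (p : ModelProd n) (hp : 0 < p.snd) :
    ∃ A : ModelProd n →L[ℝ] ModelProd n, HasFDerivAt (polarPar x) A p ∧
      |A.det| = p.snd ^ n * kap p.fst ^ n := by
  let P1 : ModelProd n →L[ℝ] Model n := WithLp.fstL 2 ℝ (Model n) ℝ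
  let P2 : ModelProd n →L[ℝ] ℝ := WithLp.sndL 2 ℝ (Model n) ℝ
  let D := fderiv ℝ (fun w => (par x w : Ambient n)) p.fst
  have hd : HasFDerivAt (fun w => (par x w : Ambient n)) D (P1 p) :=
    ((contDiff_par_coe x).differentiable (by simp) p.fst).hasFDerivAt
  have h1 := P2.hasFDerivAt (x := p) |>.smul (hd.comp p P1.hasFDerivAt)
  have h2 := (splitAmbient n).toContinuousLinearEquiv.toContinuousLinearMap.hasFDerivAt
    (x := p.snd • (par x p.fst : Ambient n)) |>.comp p h1
  obtain ⟨A, hA, he⟩ : ∃ A : ModelProd n →L[ℝ] ModelProd n, HasFDerivAt (polarPar x) A p ∧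
      ∀ q, A q = splitAmbient n (p.snd • D q.fst + q.snd • (par x p.fst : Ambient n)) :=
    ⟨_, h2, fun q => rfl⟩
  refine ⟨A, hA, ?_⟩
  have hk := kap_pos p.fst
  have ha : p.snd * kap p.fst ≠ 0 := by positivity
  let B : ModelProd n ≃ₗ[ℝ] ModelProd n :=
    (WithLp.linearEquiv 2 ℝ (Model n × ℝ)).trans
      (((LinearEquiv.smulOfNeZero ℝ (Model n) _ ha).prodCongr (LinearEquiv.refl ℝ ℝ)).trans
        (WithLp.linearEquiv 2 ℝ (Model n × ℝ)).symm)
  have hB : |LinearMap.det (A : ModelProd n →ₗ[ℝ] ModelProd n)| =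
      |LinearMap.det (B : ModelProd n →ₗ[ℝ] ModelProd n)| := by
    apply abs_det_eq_of_norm_eq
    intro q
    rw [ContinuousLinearMap.coe_coe, he, LinearIsometryEquiv.norm_map, ← sq_eq_sq₀ (norm_nonneg _) (norm_nonneg _),
      norm_add_sq_real, inner_smul_left, inner_smul_right, inner_fderiv_par,
      WithLp.prod_norm_sq_eq_of_L2, norm_smul, norm_smul, norm_fderiv_par]
    have e1 : (B q).fst = (p.snd * kap p.fst) • q.fst := rfl
    have e2 : (B q).snd = q.snd := rfl
    rw [e1, e2, norm_smul]
    simp [mul_pow]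
    ring
  have hdetB : LinearMap.det (B : ModelProd n →ₗ[ℝ] ModelProd n) = (p.snd * kap p.fst) ^ n := by
    have e : (B : ModelProd n →ₗ[ℝ] ModelProd n) =
        ((WithLp.linearEquiv 2 ℝ (Model n × ℝ)).symm : _ →ₗ[ℝ] _) ∘ₗ
          (((p.snd * kap p.fst) • (LinearMap.id : Model n →ₗ[ℝ] Model n)).prodMap
            (LinearMap.id : ℝ →ₗ[ℝ] ℝ)) ∘ₗ
        ((WithLp.linearEquiv 2 ℝ (Model n × ℝ)).symm.symm : _ →ₗ[ℝ] _) := by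
      ext q : 1; rfl
    rw [e, LinearMap.det_conj, LinearMap.det_prodMap, LinearMap.det_smul]
    simp
  rw [ContinuousLinearMap.det, hB, hdetB, abs_of_pos (by positivity), mul_pow]

open scoped Pointwise

/-- The cone over a point lies in a line, which is a null set of `ℝ^(n+1)` as `n ≥ 1`. -/
lemma surf_singleton (hn : 1 ≤ n) (y : Sph n) : surf n {y} = 0 := by
  unfold surf
  rw [Measure.toSphere_apply' _ (measurableSet_singleton y)]
  have : volume (Set.Ioo (0 : ℝ) 1 • ((↑) '' ({y} : Set (Sph n)) : Set (Ambient n))) = 0 := by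
    refine measure_mono_null (t := (Submodule.span ℝ {(y : Ambient n)} : Set (Ambient n))) ?_ ?_
    · rintro _ ⟨r, _, _, ⟨_, rfl, rfl⟩, rfl⟩
      exact Submodule.smul_mem _ _ (Submodule.mem_span_singleton_self _)
    · apply Measure.addHaar_submodule
      intro h
      have h1 := finrank_span_le_card (R := ℝ) ({(y : Ambient n)} : Set (Ambient n))
      rw [h, finrank_top] at h1
      simp at h1
      omega
  rw [this, mul_zero]

/-- `toSphere` is `n + 1` times the volume of the cone over a set. In the coordinates `polarPar` the
cone is a product with Jacobian `r^n kap^n`, and `∫₀¹ r^n = 1 / (n + 1)` cancels the factor. The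
point `-x`, missed by `par x`, is null. -/
lemma surf_eq_map_par (hn : 1 ≤ n) (x : Sph n) :
    surf n = (volume.withDensity fun w => ENNReal.ofReal (kap w ^ n)).map (par x) := by
  ext s hs
  have hpm : Measurable (par x) := (continuous_par x).measurable
  rw [Measure.map_apply hpm hs, withDensity_apply _ (hpm hs)]
  set S := par x ⁻¹' s with hS
  rw [← measure_sdiff_null (s := s) (surf_singleton hn (-x))]
  unfold surf
  rw [Measure.toSphere_apply' _ (hs.diff (measurableSet_singleton _))]
  set A : Set (ModelProd n) := (WithLp.ofLp : ModelProd n → Model n × ℝ) ⁻¹' (S ×ˢ Set.Ioo (0:ℝ) 1)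
    with hA
  have hof := WithLp.volume_preserving_ofLp (Model n) ℝ
  have hAm : MeasurableSet A := hof.measurable ((hpm hs).prod measurableSet_Ioo)
  have himg : polarPar x '' A =
      splitAmbient n '' (Set.Ioo (0 : ℝ) 1 • ((↑) '' (s \ {-x}) : Set (Ambient n))) := by
    apply Set.Subset.antisymm
    · rintro _ ⟨p, ⟨hp1, hp2⟩, rfl⟩
      exact ⟨_, ⟨_, hp2, _, ⟨par x p.fst, ⟨hp1, par_ne_neg x _⟩, rfl⟩, rfl⟩, rfl⟩
    · rintro _ ⟨_, ⟨r, hr, _, ⟨y, ⟨hy1, hy2⟩, rfl⟩, rfl⟩, rfl⟩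
      have e := par_chart x hy2
      refine ⟨WithLp.toLp 2 (chartAt (Model n) x y, r), ⟨?_, hr⟩, ?_⟩
      · change par x (chartAt (Model n) x y) ∈ s
        rwa [e]
      · change splitAmbient n (r • (par x (chartAt (Model n) x y) : Ambient n)) = _
        rw [e]
  have hinj : Set.InjOn (polarPar x) A := by
    rintro p ⟨-, hp⟩ q ⟨-, hq⟩ h
    have hp : 0 < p.snd := hp.1
    have hq : 0 < q.snd := hq.1
    have h := (splitAmbient n).injective h
    have e1 : p.snd = q.snd := by
      have := congrArg norm h
      simpa [norm_smul, abs_of_pos hp, abs_of_pos hq] using this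
    rw [e1] at h
    have e2 : p.fst = q.fst := par_injective x (Subtype.ext (smul_right_injective _ hq.ne' h))
    exact WithLp.ofLp_injective 2 (Prod.ext e2 e1)
  have hd : ∀ p ∈ A, ∃ L : ModelProd n →L[ℝ] ModelProd n, HasFDerivAt (polarPar x) L p ∧
      |L.det| = p.snd ^ n * kap p.fst ^ n := fun p hp => polarPar_hasFDerivAt x p hp.2.1
  choose! L hL hLdet using hd
  have key := lintegral_abs_det_fderiv_eq_addHaar_image volume hAm
    (fun p hp => (hL p hp).hasFDerivWithinAt) hinj
  rw [himg, LinearIsometryEquiv.image_eq_preimage_symm,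
    (splitAmbient n).symm.measurePreserving.measure_preimage_emb
      (splitAmbient n).symm.toHomeomorph.measurableEmbedding] at key
  rw [← key]
  have h1 : ∫⁻ p in A, ENNReal.ofReal |(L p).det| =
      ∫⁻ p in A, ENNReal.ofReal (kap p.ofLp.1 ^ n) * ENNReal.ofReal (p.ofLp.2 ^ n) := by
    refine setLIntegral_congr_fun hAm fun p hp => ?_
    rw [hLdet p hp, mul_comm, ENNReal.ofReal_mul (pow_nonneg (kap_pos _).le _)]
    rfl
  have hkm : Measurable fun w : Model n => ENNReal.ofReal (kap w ^ n) :=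
    (continuous_kap.pow n).measurable.ennreal_ofReal
  have h2 : ∫⁻ p in A, ENNReal.ofReal (kap p.ofLp.1 ^ n) * ENNReal.ofReal (p.ofLp.2 ^ n) =
      ∫⁻ q in S ×ˢ Set.Ioo (0:ℝ) 1, ENNReal.ofReal (kap q.1 ^ n) * ENNReal.ofReal (q.2 ^ n) :=
    hof.setLIntegral_comp_preimage ((hpm hs).prod measurableSet_Ioo)
      (f := fun q : Model n × ℝ => ENNReal.ofReal (kap q.1 ^ n) * ENNReal.ofReal (q.2 ^ n))
      ((hkm.comp measurable_fst).mul (by fun_prop))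
  have h3 : ∫⁻ r in Set.Ioo (0:ℝ) 1, ENNReal.ofReal (r ^ n) = ENNReal.ofReal (1 / (n + 1)) := by
    rw [Measure.restrict_congr_set Ioo_ae_eq_Ioc,
      ← ofReal_integral_eq_lintegral_ofReal (intervalIntegral.intervalIntegrable_pow n).1,
      ← intervalIntegral.integral_of_le zero_le_one]
    · simp
    · filter_upwards [ae_restrict_mem measurableSet_Ioc] with y hy
      exact pow_nonneg hy.1.le _
  rw [h1, h2, Measure.volume_eq_prod, ← Measure.prod_restrict,
    lintegral_prod_mul (g := fun r : ℝ => ENNReal.ofReal (r ^ n)) hkm.aemeasurable (by fun_prop), h3]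
  have h4 : (finrank ℝ (Ambient n) : ENNReal) * ENNReal.ofReal (1 / (n + 1)) = 1 := by
    rw [← ENNReal.ofReal_natCast, ← ENNReal.ofReal_mul (by positivity)]
    simp
    field_simp
  rw [mul_left_comm, h4, mul_one]

lemma lintegral_surf (hn : 1 ≤ n) (x : Sph n) {g : Sph n → ENNReal} (hg : Measurable g) :
    ∫⁻ y, g y ∂(surf n) = ∫⁻ w : Model n, ENNReal.ofReal (kap w ^ n) * g (par x w) := by
  have hpm : Measurable (par x) := (continuous_par x).measurable
  have hkm : Measurable fun w : Model n => ENNReal.ofReal (kap w ^ n) :=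
    (continuous_kap.pow n).measurable.ennreal_ofReal
  rw [surf_eq_map_par hn x, lintegral_map hg hpm]
  exact lintegral_withDensity_eq_lintegral_mul _ hkm (hg.comp hpm)

instance : IsFiniteMeasure (surf n) := by unfold surf; infer_instance

/-! ### Conformal factors and the Jacobian -/

/-- The map `Φ` scales distances infinitesimally by `s`. -/
structure HasScale (Φ : Sph n ≃ₘ⟮𝓡 n, 𝓡 n⟯ Sph n) (s : Sph n → ℝ) : Prop where
  pos : ∀ x, 0 < s x
  tendsto : ∀ x, Tendsto (fun y => chord (Φ y) (Φ x) / chord y x) (𝓝[≠] x) (𝓝 (s x))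

lemma hasScale_refl : HasScale (Diffeomorph.refl (𝓡 n) (Sph n) ∞) fun _ => 1 where
  pos _ := one_pos
  tendsto x := by
    refine tendsto_const_nhds.congr' ?_
    filter_upwards [self_mem_nhdsWithin] with y hy
    exact (div_self (chord_ne_zero hy)).symm

lemma tendsto_par (x : Sph n) (w : Model n) :
    Tendsto (par x) (𝓝[≠] w) (𝓝[≠] (par x w)) := by
  refine tendsto_nhdsWithin_iff.2 ⟨((continuous_par x).tendsto w).mono_left nhdsWithin_le_nhds, ?_⟩
  filter_upwards [self_mem_nhdsWithin] with z hz
  exact fun h => hz (par_injective x h)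

lemma continuousAt_chart (x : Sph n) {y : Sph n} (hy : y ≠ -x) :
    ContinuousAt (chartAt (Model n) x) y :=
  (chartAt (Model n) x).continuousAt (by rw [chart_source]; exact hy)

lemma ne_neg_self (x : Sph n) : x ≠ -x := by
  simpa using par_ne_neg x 0

lemma tendsto_chart (x : Sph n) :
    Tendsto (chartAt (Model n) x) (𝓝[≠] x) (𝓝[≠] 0) := by
  have h := continuousAt_chart x (ne_neg_self x)
  unfold ContinuousAt at h
  rw [chart_self] at h
  refine tendsto_nhdsWithin_iff.2 ⟨h.mono_left nhdsWithin_le_nhds, ?_⟩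
  have h2 : ∀ᶠ y in 𝓝[≠] x, y ≠ -x :=
    nhdsWithin_le_nhds (isOpen_ne.mem_nhds (ne_neg_self x))
  filter_upwards [self_mem_nhdsWithin, h2] with y hy hy2 h0
  apply hy
  rw [Set.mem_singleton_iff] at h0 ⊢
  rw [← par_chart x hy2, h0, par_zero]

lemma kap_zero : kap (0 : Model n) = 1 := by simp [kap]

lemma HasScale.tendsto_par {Φ : Sph n ≃ₘ⟮𝓡 n, 𝓡 n⟯ Sph n} {s : Sph n → ℝ} (h : HasScale Φ s)
    (x : Sph n) (w : Model n) :
    Tendsto (fun z => chord (Φ (par x z)) (Φ (par x w)) / ‖z - w‖) (𝓝[≠] w)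
      (𝓝 (s (par x w) * kap w)) := by
  refine (((h.tendsto (par x w)).comp (ConformalLog.tendsto_par x w)).mul
    (tendsto_chord_par x w)).congr' ?_
  filter_upwards [self_mem_nhdsWithin] with z hz
  have : chord (par x z) (par x w) ≠ 0 := chord_ne_zero fun e => hz (par_injective x e)
  simp only [Function.comp_apply]
  field_simp

/-- Polarization. -/
lemma inner_map_map_of_norm {E F : Type*} [NormedAddCommGroup E] [InnerProductSpace ℝ E]
    [NormedAddCommGroup F] [InnerProductSpace ℝ F] (A : E →L[ℝ] F) {μ : ℝ}
    (h : ∀ a, ‖A a‖ = μ * ‖a‖) (a b : E) : inner ℝ (A a) (A b) = μ ^ 2 * inner ℝ a b := by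
  have h1 := norm_add_sq_real (A a) (A b)
  have h2 := norm_add_sq_real a b
  rw [← map_add, h, h, h, mul_pow, h2] at h1
  linarith

lemma hasFDerivAt_coe_par {Ψ : Sph n → Sph n} (hΨ : ContMDiff (𝓡 n) (𝓡 n) ∞ Ψ) (x : Sph n) :
    HasFDerivAt (fun w => (Ψ (par x w) : Ambient n)) (tangentMap Ψ x) 0 := by
  rw [tangentMap_eq hΨ]
  exact ((contDiff_comp_par (contMDiff_coe_comp hΨ) x).differentiable (by simp) 0).hasFDerivAt

lemma HasScale.norm_tangentMap {Φ : Sph n ≃ₘ⟮𝓡 n, 𝓡 n⟯ Sph n} {s : Sph n → ℝ}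
    (h : HasScale Φ s) (x : Sph n) (a : Model n) : ‖tangentMap Φ x a‖ = s x * ‖a‖ := by
  refine norm_fderiv_of_tendsto (hasFDerivAt_coe_par Φ.contMDiff x) ?_ a
  have := h.tendsto_par x 0
  rw [kap_zero, mul_one, par_zero] at this
  simpa only [par_zero, chord] using this

lemma HasScale.pullbackMetric {Φ : Sph n ≃ₘ⟮𝓡 n, 𝓡 n⟯ Sph n} {s : Sph n → ℝ}
    (h : HasScale Φ s) (x : Sph n) (a b : Model n) :
    pullbackMetric Φ x a b = s x ^ 2 * inner ℝ a b :=
  inner_map_map_of_norm _ (h.norm_tangentMap x) a b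

/-- Since `kap 0 = 1`, the coordinate basis of the chart centred at `x` is orthonormal at `x`. -/
lemma pullbackMetric_id (x : Sph n) (a b : Model n) : pullbackMetric id x a b = inner ℝ a b := by
  have := hasScale_refl.pullbackMetric x a b
  rw [one_pow, one_mul] at this
  exact this

lemma HasScale.metricMatrix {Φ : Sph n ≃ₘ⟮𝓡 n, 𝓡 n⟯ Sph n} {s : Sph n → ℝ}
    (h : HasScale Φ s) (x : Sph n) : metricMatrix Φ x = s x ^ 2 • (1 : Matrix (Fin n) (Fin n) ℝ) := by
  ext i j
  simp only [ConformalLog.metricMatrix, Matrix.of_apply, h.pullbackMetric, Matrix.smul_apply,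
    smul_eq_mul]
  congr 1
  rw [Matrix.one_apply]
  simp [EuclideanSpace.inner_single_left]

lemma HasScale.jac_eq {Φ : Sph n ≃ₘ⟮𝓡 n, 𝓡 n⟯ Sph n} {s : Sph n → ℝ}
    (h : HasScale Φ s) (x : Sph n) : jac Φ x = s x ^ n := by
  have h1 : (ConformalLog.metricMatrix id x).det = 1 := by
    have := hasScale_refl.metricMatrix x
    rw [one_pow, one_smul] at this
    change (ConformalLog.metricMatrix id x) = 1 at this
    rw [this, Matrix.det_one]
  unfold jac
  rw [h1, h.metricMatrix, Matrix.det_smul, Matrix.det_one, Fintype.card_fin, mul_one, div_one,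
    ← pow_mul, mul_comm, pow_mul, Real.sqrt_sq (pow_nonneg (h.pos x).le _)]

/-- The factor is `√c`, as `c` multiplies squared norms. Difference quotients are taken in the chart
at `x` and divided by those of the chart itself, which tend to `kap 0 = 1`. -/
lemma IsConformal.exists_hasScale {Φ : Sph n ≃ₘ⟮𝓡 n, 𝓡 n⟯ Sph n} (hΦ : IsConformal Φ) :
    ∃ s, HasScale Φ s := by
  choose c hc hcm using hΦ.conformal
  refine ⟨fun x => √(c x), fun x => Real.sqrt_pos.2 (hc x), fun x => ?_⟩
  have h1 : ∀ a, ‖tangentMap Φ x a‖ = √(c x) * ‖a‖ := by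
    intro a
    have := hcm x a a
    rw [pullbackMetric_id, ConformalLog.pullbackMetric, real_inner_self_eq_norm_sq,
      real_inner_self_eq_norm_sq] at this
    rw [← Real.sqrt_sq (norm_nonneg (tangentMap Φ x a)), this, Real.sqrt_mul (hc x).le,
      Real.sqrt_sq (norm_nonneg a)]
  have h2 := (tendsto_of_norm_fderiv (hasFDerivAt_coe_par Φ.contMDiff x) h1).comp (tendsto_chart x)
  have h3 := (tendsto_chord_par x 0).comp (tendsto_chart x)
  rw [kap_zero] at h3
  have h4 := h2.div h3 one_ne_zero
  rw [div_one] at h4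
  refine h4.congr' ?_
  have h5 : ∀ᶠ y in 𝓝[≠] x, y ≠ -x :=
    nhdsWithin_le_nhds (isOpen_ne.mem_nhds (ne_neg_self x))
  filter_upwards [self_mem_nhdsWithin, h5] with y hy hy2
  simp only [Function.comp_apply, Pi.div_apply, par_chart x hy2, par_zero, sub_zero]
  have h6 : ‖chartAt (Model n) x y‖ ≠ 0 := by
    rw [norm_ne_zero_iff]
    intro h0
    apply hy
    rw [Set.mem_singleton_iff, ← par_chart x hy2, h0, par_zero]
  rw [div_div_div_cancel_right₀ h6]
  rfl

lemma HasScale.symm {Φ : Sph n ≃ₘ⟮𝓡 n, 𝓡 n⟯ Sph n} {s : Sph n → ℝ}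
    (h : HasScale Φ s) : HasScale Φ.symm fun x => (s (Φ.symm x))⁻¹ where
  pos x := inv_pos.2 (h.pos _)
  tendsto x := by
    have h1 : Tendsto Φ.symm (𝓝[≠] x) (𝓝[≠] (Φ.symm x)) := by
      refine tendsto_nhdsWithin_iff.2
        ⟨(Φ.symm.continuous.tendsto x).mono_left nhdsWithin_le_nhds, ?_⟩
      filter_upwards [self_mem_nhdsWithin] with z hz
      exact fun e => hz (Φ.symm.injective e)
    have h2 := ((h.tendsto (Φ.symm x)).comp h1).inv₀ (h.pos _).ne'
    refine h2.congr fun y => ?_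
    simp

/-! ### The map in coordinates and change of variables -/

/-- The map `Φ` in stereographic coordinates, with poles `-x` and `Φ (-x)`. -/
def chartMap (Φ : Sph n ≃ₘ⟮𝓡 n, 𝓡 n⟯ Sph n) (x : Sph n) (w : Model n) : Model n :=
  chartAt (Model n) (-Φ (-x)) (Φ (par x w))

lemma par_chartMap (Φ : Sph n ≃ₘ⟮𝓡 n, 𝓡 n⟯ Sph n) (x : Sph n) (w : Model n) :
    par (-Φ (-x)) (chartMap Φ x w) = Φ (par x w) := by
  refine par_chart _ ?_
  rw [neg_neg]
  exact fun e => par_ne_neg x w (Φ.injective e)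

lemma contDiff_chartMap (Φ : Sph n ≃ₘ⟮𝓡 n, 𝓡 n⟯ Sph n) (x : Sph n) :
    ContDiff ℝ ∞ (chartMap Φ x) := by
  rw [← contMDiff_iff_contDiff, ← contMDiffOn_univ]
  refine (contMDiffOn_chart' (-Φ (-x))).comp (Φ.contMDiff.comp (contMDiff_par x)).contMDiffOn ?_
  intro w _
  rw [Set.mem_preimage, Set.mem_compl_singleton_iff, neg_neg]
  exact fun e => par_ne_neg x w (Φ.injective e)

lemma chartMap_injective (Φ : Sph n ≃ₘ⟮𝓡 n, 𝓡 n⟯ Sph n) (x : Sph n) :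
    Function.Injective (chartMap Φ x) := fun w z h =>
  par_injective x (Φ.injective (by
    change Φ (par x w) = Φ (par x z)
    rw [← par_chartMap, ← par_chartMap, h]))

lemma chartMap_surjective (Φ : Sph n ≃ₘ⟮𝓡 n, 𝓡 n⟯ Sph n) (x : Sph n) :
    Function.Surjective (chartMap Φ x) := by
  intro z
  refine ⟨chartAt (Model n) x (Φ.symm (par (-Φ (-x)) z)), ?_⟩
  have h : Φ.symm (par (-Φ (-x)) z) ≠ -x := by
    intro e
    have h2 := par_ne_neg (-Φ (-x)) z
    rw [neg_neg] at h2
    exact h2 ((Φ.apply_symm_apply _).symm.trans (congrArg Φ e))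
  apply par_injective (-Φ (-x))
  rw [par_chartMap, par_chart x h]
  simp

/-- The factor is a product of three: `kap w` from the parametrization, `s` from `Φ`, and the
inverse of `kap` from the chart of the target. -/
lemma HasScale.norm_fderiv_chartMap {Φ : Sph n ≃ₘ⟮𝓡 n, 𝓡 n⟯ Sph n} {s : Sph n → ℝ}
    (h : HasScale Φ s) (x : Sph n) (w a : Model n) :
    ‖fderiv ℝ (chartMap Φ x) w a‖ = s (par x w) * kap w / kap (chartMap Φ x w) * ‖a‖ := by
  have hd := (contDiff_chartMap Φ x).differentiable (by simp)
  refine norm_fderiv_of_tendsto (hd w).hasFDerivAt ?_ a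
  have h1 : Tendsto (fun z => √(kap (chartMap Φ x z)) * √(kap (chartMap Φ x w))) (𝓝[≠] w)
      (𝓝 (kap (chartMap Φ x w))) := by
    have : Continuous fun z => √(kap (chartMap Φ x z)) * √(kap (chartMap Φ x w)) :=
      ((continuous_kap.comp hd.continuous).sqrt).mul continuous_const
    have := (this.tendsto w).mono_left (nhdsWithin_le_nhds (s := {w}ᶜ))
    rwa [Real.mul_self_sqrt (kap_pos _).le] at this
  refine ((h.tendsto_par x w).div h1 (kap_pos _).ne').congr fun z => ?_
  have h2 := Real.sqrt_pos.2 (kap_pos (chartMap Φ x z))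
  have h3 := Real.sqrt_pos.2 (kap_pos (chartMap Φ x w))
  simp only [Pi.div_apply]
  rw [← par_chartMap, ← par_chartMap, chord_par_eq]
  field_simp

/-- `s` is given only as a pointwise limit. In coordinates it is expressed through the norm of the
derivative of the smooth map `chartMap` on one unit vector, which exists because `n ≥ 1`. -/
lemma HasScale.continuous (hn : 1 ≤ n) {Φ : Sph n ≃ₘ⟮𝓡 n, 𝓡 n⟯ Sph n} {s : Sph n → ℝ}
    (h : HasScale Φ s) : Continuous s := by
  rw [continuous_iff_continuousAt]
  intro x
  let e : Model n := EuclideanSpace.single ⟨0, hn⟩ 1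
  have he : ‖e‖ = 1 := by simp [e]
  let f := chartMap Φ x
  have hf := contDiff_chartMap Φ x
  have h1 : Continuous fun w => ‖fderiv ℝ f w e‖ * kap (f w) / kap w :=
    (((hf.continuous_fderiv (by simp)).clm_apply continuous_const).norm.mul
      (continuous_kap.comp hf.continuous)).div continuous_kap fun w => (kap_pos w).ne'
  have h2 : ContinuousAt (fun y => s (par x (chartAt (Model n) x y))) x := by
    have h3 : (fun w => s (par x w)) = fun w => ‖fderiv ℝ f w e‖ * kap (f w) / kap w := by
      ext w
      have := kap_pos w
      have := kap_pos (f w)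
      rw [h.norm_fderiv_chartMap, he]
      change s (par x w) = s (par x w) * kap w / kap (f w) * 1 * kap (f w) / kap w
      field_simp
    rw [← h3] at h1
    exact h1.continuousAt.comp (f := chartAt (Model n) x)
      (continuousAt_chart x (ne_neg_self x))
  refine h2.congr ?_
  filter_upwards [isOpen_ne.mem_nhds (ne_neg_self x)] with y hy
  rw [par_chart x hy]

/-- Change of variables under a conformal map. -/
lemma HasScale.lintegral_comp (hn : 1 ≤ n) {Φ : Sph n ≃ₘ⟮𝓡 n, 𝓡 n⟯ Sph n} {s : Sph n → ℝ}
    (h : HasScale Φ s) {g : Sph n → ENNReal} (hg : Measurable g) :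
    ∫⁻ y, ENNReal.ofReal (s y ^ n) * g (Φ y) ∂(surf n) = ∫⁻ y, g y ∂(surf n) := by
  have hsm : Measurable s := (h.continuous hn).measurable
  obtain ⟨x⟩ : Nonempty (Sph n) := ⟨⟨EuclideanSpace.single 0 1, by simp⟩⟩
  have hm : Measurable fun y => ENNReal.ofReal (s y ^ n) * g (Φ y) :=
    (hsm.pow_const n).ennreal_ofReal.mul (hg.comp Φ.continuous.measurable)
  rw [lintegral_surf hn x hm, lintegral_surf hn (-Φ (-x)) hg]
  have hf := (contDiff_chartMap Φ x).differentiable (by simp)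
  -- With the poles matched, `chartMap` is a bijection of `ℝ^n`, so a single global substitution
  -- suffices.
  have key := lintegral_image_eq_lintegral_abs_det_fderiv_mul volume MeasurableSet.univ
    (fun w _ => (hf w).hasFDerivAt.hasFDerivWithinAt) (chartMap_injective Φ x).injOn
    (fun z => ENNReal.ofReal (kap z ^ n) * g (par (-Φ (-x)) z))
  rw [Set.image_univ, (chartMap_surjective Φ x).range_eq, Measure.restrict_univ] at key
  rw [key]
  refine lintegral_congr fun w => ?_
  have h1 := kap_pos w
  have h2 := kap_pos (chartMap Φ x w)
  have h3 := h.pos (par x w)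
  have hdet : |(fderiv ℝ (chartMap Φ x) w).det| =
      (s (par x w) * kap w / kap (chartMap Φ x w)) ^ n := by
    have := abs_det_of_norm_eq_mul (fderiv ℝ (chartMap Φ x) w : Model n →ₗ[ℝ] Model n)
      (μ := s (par x w) * kap w / kap (chartMap Φ x w)) (by positivity)
      (h.norm_fderiv_chartMap x w)
    rw [finrank_euclideanSpace_fin] at this
    exact this
  rw [hdet, par_chartMap, ← mul_assoc, ← mul_assoc, ← ENNReal.ofReal_mul (by positivity),
    ← ENNReal.ofReal_mul (by positivity), ← mul_pow, ← mul_pow]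
  congr 3
  field_simp

/-! ### Liouville's theorem for entire conformal maps -/

section Liouville

variable {E F : Type*} [NormedAddCommGroup E] [InnerProductSpace ℝ E]
  [NormedAddCommGroup F] [InnerProductSpace ℝ F]

/-- The derivative of `g` in the direction `h`. -/
def dir (h : E) (g : E → F) : E → F := fun x => fderiv ℝ g x h

lemma contDiff_dir {g : E → F} (hg : ContDiff ℝ ∞ g) (h : E) : ContDiff ℝ ∞ (dir h g) :=
  (hg.fderiv_right (by simp)).clm_apply contDiff_const

lemma dir_dir {g : E → F} (hg : ContDiff ℝ ∞ g) (h k : E) (x : E) :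
    dir h (dir k g) x = fderiv ℝ (fderiv ℝ g) x h k := by
  have h1 : DifferentiableAt ℝ (fderiv ℝ g) x :=
    (hg.fderiv_right (m := ∞) (by simp)).differentiable (by simp) x
  unfold dir
  rw [fderiv_clm_apply h1 (differentiableAt_const k)]
  simp

lemma dir_comm {g : E → F} (hg : ContDiff ℝ ∞ g) (h k : E) :
    dir h (dir k g) = dir k (dir h g) := by
  ext x
  rw [dir_dir hg, dir_dir hg]
  exact (hg.contDiffAt.isSymmSndFDerivAt (by
    rw [minSmoothness_of_isRCLikeNormedField]
    exact WithTop.coe_le_coe.2 le_top)) h k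

lemma dir_add_left (g : E → F) (h k : E) : dir (h + k) g = dir h g + dir k g := by
  ext x; simp [dir]

lemma dir_smul_left (g : E → F) (c : ℝ) (h : E) : dir (c • h) g = c • dir h g := by
  ext x; simp [dir]

lemma dir_add {g k : E → F} (hg : ContDiff ℝ ∞ g) (hk : ContDiff ℝ ∞ k) (h : E) :
    dir h (g + k) = dir h g + dir h k := by
  ext x
  simp only [dir, Pi.add_apply]
  rw [fderiv_add (hg.differentiable (by simp) x) (hk.differentiable (by simp) x)]
  rfl

lemma dir_smul {p : E → ℝ} {g : E → F} (hp : ContDiff ℝ ∞ p) (hg : ContDiff ℝ ∞ g) (h : E) :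
    dir h (p • g) = dir h p • g + p • dir h g := by
  ext x
  simp only [dir, Pi.add_apply, Pi.smul_apply']
  rw [fderiv_smul (hp.differentiable (by simp) x) (hg.differentiable (by simp) x)]
  simp [add_comm]

lemma dir_inner {g k : E → F} (hg : ContDiff ℝ ∞ g) (hk : ContDiff ℝ ∞ k) (h x : E) :
    dir h (fun x => inner ℝ (g x) (k x)) x = inner ℝ (g x) (dir h k x) + inner ℝ (dir h g x) (k x) := by
  simp only [dir]
  rw [fderiv_inner_apply ℝ (hg.differentiable (by simp) x) (hk.differentiable (by simp) x)]

lemma dir_const (c : F) (h : E) : dir h (fun _ => c) = 0 := by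
  ext x; simp [dir]

variable [FiniteDimensional ℝ E]

/-- The derivative is injective, hence surjective in finite dimension, so `w` itself is one of its
values. -/
lemma eq_zero_of_inner_fderiv {f : E → E} {μ : E → ℝ} (hμ : ∀ x, 0 < μ x)
    (hf : ∀ x h, ‖fderiv ℝ f x h‖ = μ x * ‖h‖) {x w : E}
    (hw : ∀ h, inner ℝ w (fderiv ℝ f x h) = 0) : w = 0 := by
  have hinj : Function.Injective (fderiv ℝ f x : E →ₗ[ℝ] E) := by
    rw [injective_iff_map_eq_zero]
    intro a ha
    have h1 := hf x a
    have h2 : fderiv ℝ f x a = 0 := ha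
    rw [h2, norm_zero] at h1
    have := (mul_eq_zero.1 h1.symm).resolve_left (hμ x).ne'
    exact norm_eq_zero.1 this
  obtain ⟨h, hh⟩ := LinearMap.injective_iff_surjective.1 hinj w
  have := hw h
  have h2 : fderiv ℝ f x h = w := hh
  rw [h2] at this
  exact inner_self_eq_zero.1 this

/-- A map whose derivative multiplies norms by a constant is a similarity. -/
lemma norm_sub_of_norm_fderiv_const {f : E → E} (hs : ContDiff ℝ ∞ f) {c : ℝ} (hc : 0 < c)
    (hf : ∀ x h, ‖fderiv ℝ f x h‖ = c * ‖h‖) (x y : E) : ‖f x - f y‖ = c * ‖x - y‖ := by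
  have hin : ∀ h k x, inner ℝ (dir h f x) (dir k f x) = c ^ 2 * inner ℝ h k := fun h k x =>
    inner_map_map_of_norm _ (hf x) h k
  have hT : ∀ i j k x, inner ℝ (dir i (dir j f) x) (dir k f x) =
      -inner ℝ (dir i (dir k f) x) (dir j f x) := by
    intro i j k x
    have h1 := dir_inner (contDiff_dir hs j) (contDiff_dir hs k) i x
    have h2 : (fun x => inner ℝ (dir j f x) (dir k f x)) = fun _ => c ^ 2 * inner ℝ j k :=
      funext fun x => hin j k x
    rw [h2, dir_const, Pi.zero_apply, real_inner_comm (dir i (dir k f) x) (dir j f x)] at h1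
    linarith
  -- The numbers `⟨∂ᵢ∂ⱼf, ∂ₖf⟩` are symmetric in `i, j` and antisymmetric in `j, k`, so they vanish.
  have hz : ∀ i j x, dir i (dir j f) x = 0 := by
    intro i j x
    refine eq_zero_of_inner_fderiv (fun _ => hc) hf (x := x) fun k => ?_
    change inner ℝ (dir i (dir j f) x) (dir k f x) = 0
    have h1 := hT i j k x
    have h2 := hT k i j x
    have h3 := hT j k i x
    rw [dir_comm hs i k] at h1
    rw [dir_comm hs k j] at h2
    rw [dir_comm hs j i] at h3
    linarith
  have hconst : ∀ x, fderiv ℝ f x = fderiv ℝ f 0 := by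
    intro x
    refine is_const_of_fderiv_eq_zero (𝕜 := ℝ)
      ((hs.fderiv_right (m := ∞) (by simp)).differentiable (by simp)) (fun z => ?_) x 0
    ext i j
    rw [← dir_dir hs, hz]
    simp
  have h1 : ∀ z, f z - fderiv ℝ f 0 z = f 0 - fderiv ℝ f 0 0 := by
    intro z
    refine is_const_of_fderiv_eq_zero (𝕜 := ℝ) (f := fun z => f z - fderiv ℝ f 0 z)
      ((hs.differentiable (by simp)).sub (fderiv ℝ f 0).differentiable) (fun z => ?_) z 0
    rw [fderiv_fun_sub (hs.differentiable (by simp) z) (fderiv ℝ f 0).differentiableAt,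
      ContinuousLinearMap.fderiv, hconst z, sub_self]
  have h2 : f x - f y = fderiv ℝ f 0 (x - y) := by
    rw [map_sub]
    have hx := h1 x
    have hy := h1 y
    rw [← hy] at hx
    rw [sub_eq_sub_iff_add_eq_add] at hx ⊢
    rw [hx]
    abel
  rw [h2, hf]

/-- A bounded function with vanishing third derivative is constant. -/
lemma deriv_zero_of_bounded {g g1 g2 : ℝ → ℝ} {M : ℝ} (h1 : ∀ t, HasDerivAt g (g1 t) t)
    (h2 : ∀ t, HasDerivAt g1 (g2 t) t) (h3 : ∀ t, HasDerivAt g2 0 t) (hM : ∀ t, |g t| ≤ M) :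
    g1 0 = 0 := by
  have e2 : ∀ t, g2 t = g2 0 := fun t =>
    is_const_of_deriv_eq_zero (fun t => (h3 t).differentiableAt) (fun t => (h3 t).deriv) t 0
  have e1 : ∀ t, g1 t - g2 0 * t = g1 0 - g2 0 * 0 := fun t => by
    have hd : ∀ t, HasDerivAt (fun t => g1 t - g2 0 * t) 0 t := fun t => by
      have := (h2 t).fun_sub ((hasDerivAt_id' t).const_mul (g2 0))
      rw [e2 t] at this
      simpa using this
    exact is_const_of_deriv_eq_zero (fun t => (hd t).differentiableAt) (fun t => (hd t).deriv) t 0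
  have e0 : ∀ t, g t - g1 0 * t - g2 0 / 2 * t ^ 2 = g 0 - g1 0 * 0 - g2 0 / 2 * 0 ^ 2 := fun t => by
    have hd : ∀ t, HasDerivAt (fun t => g t - g1 0 * t - g2 0 / 2 * t ^ 2) 0 t := fun t => by
      have := ((h1 t).sub ((hasDerivAt_id t).const_mul (g1 0))).sub
        ((hasDerivAt_pow 2 t).const_mul (g2 0 / 2))
      refine this.congr_deriv ?_
      have := e1 t
      simp
      linarith
    exact is_const_of_deriv_eq_zero (fun t => (hd t).differentiableAt) (fun t => (hd t).deriv) t 0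
  by_contra hb
  have hM0 : 0 ≤ M := (abs_nonneg _).trans (hM 0)
  -- `g` is a quadratic polynomial with `g t - g (-t) = 2 g'(0) t`. This difference is at most `2
  -- M`, and `t` is chosen to make it `2 (M + 1)`.
  set t := (M + 1) / g1 0 with ht
  have ht' : g1 0 * t = M + 1 := by rw [ht]; field_simp
  have ha := e0 t
  have hb' := e0 (-t)
  have hc := abs_le.1 (hM t)
  have hd := abs_le.1 (hM (-t))
  have : g t - g (-t) = 2 * (g1 0 * t) := by linarith
  rw [ht'] at this
  linarith [hc.2, hd.1]

/-- The key point of Liouville's theorem on conformal maps: with `p` the reciprocal of the scaling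
factor of `f`, the mixed second derivatives of `p • f` are those of `p` times `f`. -/
lemma dir_dir_smul_conformal {f : E → E} {p : E → ℝ} (hs : ContDiff ℝ ∞ f) (hp : ContDiff ℝ ∞ p)
    (hp0 : ∀ x, 0 < p x) (hf : ∀ x h, ‖fderiv ℝ f x h‖ = (p x)⁻¹ * ‖h‖) {i j : E}
    (hi : ‖i‖ = 1) (hj : ‖j‖ = 1) (hij : inner ℝ i j = 0) :
    dir i (dir j (p • f)) = dir i (dir j p) • f := by
  have hin : ∀ h k x, inner ℝ (dir h f x) (dir k f x) = ((p x)⁻¹) ^ 2 * inner ℝ h k := fun h k x =>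
    inner_map_map_of_norm _ (hf x) h k
  have hji : inner ℝ j i = 0 := by rw [real_inner_comm]; exact hij
  have hqd : ∀ h x, dir h (fun x => ((p x)⁻¹) ^ 2) x = -2 * ((p x)⁻¹) ^ 3 * dir h p x := by
    intro h x
    have hd := ((hp.differentiable (by simp) x).hasFDerivAt)
    have h1 := (hasDerivAt_inv (hp0 x).ne').comp_hasFDerivAt x hd
    have h2 := h1.pow 2
    have h3 : dir h (fun x => ((p x)⁻¹) ^ 2) x = _ := congrArg (fun L => L h) h2.fderiv
    rw [h3]
    have := (hp0 x).ne'
    simp [dir]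
    field_simp
  -- The derivative in direction `a` of `⟨∂_b f, ∂_c f⟩ = p⁻² ⟨b, c⟩`.
  have hT : ∀ a b c x, inner ℝ (dir a (dir b f) x) (dir c f x) +
      inner ℝ (dir a (dir c f) x) (dir b f x) =
      -2 * ((p x)⁻¹) ^ 3 * dir a p x * inner ℝ b c := by
    intro a b c x
    have h1 := dir_inner (contDiff_dir hs b) (contDiff_dir hs c) a x
    have h2 : (fun x => inner ℝ (dir b f x) (dir c f x)) =
      (inner ℝ b c : ℝ) • fun x => ((p x)⁻¹) ^ 2 :=
      funext fun x => by rw [hin, Pi.smul_apply, smul_eq_mul, mul_comm]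
    have h3 : dir a ((inner ℝ b c : ℝ) • fun x => ((p x)⁻¹) ^ 2) x =
        (inner ℝ b c : ℝ) * dir a (fun x => ((p x)⁻¹) ^ 2) x := by
      simp only [dir]
      rw [fderiv_const_smul_field]
      rfl
    rw [h2, h3, hqd, real_inner_comm (dir a (dir c f) x) (dir b f x)] at h1
    linarith
  -- For `i ⟂ j` these are the terms of `∂ᵢ∂ⱼ(p f)` other than `(∂ᵢ∂ⱼp) f`. Their sum is tested
  -- against the derivatives of `f` along `i`, along `j`, and along vectors orthogonal to both; `hT`
  -- determines each pairing.
  have hW : ∀ x, dir i p x • dir j f x + dir j p x • dir i f x + p x • dir i (dir j f) x = 0 := by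
    intro x
    have hpx := (hp0 x).ne'
    refine eq_zero_of_inner_fderiv (fun x => inv_pos.2 (hp0 x)) hf (x := x) fun h => ?_
    change inner ℝ _ (dir h f x) = 0
    have key : ∀ k, inner ℝ i k = 0 → inner ℝ j k = 0 →
        inner ℝ (dir i p x • dir j f x + dir j p x • dir i f x + p x • dir i (dir j f) x)
          (dir k f x) = 0 := by
      intro k hik hjk
      have h1 := hT i j k x
      have h2 := hT j k i x
      have h3 := hT k i j x
      rw [dir_comm hs j k, dir_comm hs j i] at h2
      rw [dir_comm hs k i] at h3
      rw [hjk] at h1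
      rw [real_inner_comm i k, hik] at h2
      rw [hij] at h3
      have h4 : inner ℝ (dir i (dir j f) x) (dir k f x) = 0 := by linarith
      simp only [inner_add_left, inner_smul_left, hin, h4, hik, hjk]
      simp
    have keyi : inner ℝ (dir i p x • dir j f x + dir j p x • dir i f x + p x • dir i (dir j f) x)
          (dir i f x) = 0 := by
      have h1 := hT j i i x
      rw [dir_comm hs j i, real_inner_self_eq_norm_sq, hi] at h1
      have h2 : inner ℝ (dir i (dir j f) x) (dir i f x) = - ((p x)⁻¹) ^ 3 * dir j p x := by linarith
      simp only [inner_add_left, inner_smul_left, hin, h2, hji, real_inner_self_eq_norm_sq, hi]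
      simp
      field_simp
      ring
    have keyj : inner ℝ (dir i p x • dir j f x + dir j p x • dir i f x + p x • dir i (dir j f) x)
          (dir j f x) = 0 := by
      have h1 := hT i j j x
      rw [real_inner_self_eq_norm_sq, hj] at h1
      have h2 : inner ℝ (dir i (dir j f) x) (dir j f x) = - ((p x)⁻¹) ^ 3 * dir i p x := by linarith
      simp only [inner_add_left, inner_smul_left, hin, h2, hij, real_inner_self_eq_norm_sq, hj]
      simp
      field_simp
      ring
    have hdec : h = (inner ℝ i h : ℝ) • i + (inner ℝ j h : ℝ) • j +
        (h - (inner ℝ i h : ℝ) • i - (inner ℝ j h : ℝ) • j) := by abel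
    rw [hdec, dir_add_left, dir_add_left, dir_smul_left, dir_smul_left]
    simp only [Pi.add_apply, Pi.smul_apply]
    rw [inner_add_right, inner_add_right, inner_smul_right, inner_smul_right, keyi, keyj, key]
    · simp
    · simp [inner_sub_right, inner_smul_right, hij, hi]
    · simp [inner_sub_right, inner_smul_right, hji, hj]
  rw [dir_smul hp hs, dir_add ((contDiff_dir hp j).smul hs) (hp.smul (contDiff_dir hs j)),
    dir_smul (contDiff_dir hp j) hs, dir_smul hp (contDiff_dir hs j)]
  ext x
  have := hW x
  simp only [Pi.add_apply, Pi.smul_apply']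
  calc _ = dir i (dir j p) x • f x + (dir i p x • dir j f x + dir j p x • dir i f x +
      p x • dir i (dir j f) x) := by abel
    _ = _ := by rw [this, add_zero]

/-- Entire conformal maps in dimension at least three with scaling factor bounded below. -/
lemma conformal_const_of_three_le {f : E → E} {p : E → ℝ} (hs : ContDiff ℝ ∞ f)
    (hp : ContDiff ℝ ∞ p) (hp0 : ∀ x, 0 < p x)
    (hf : ∀ x h, ‖fderiv ℝ f x h‖ = (p x)⁻¹ * ‖h‖) {M : ℝ} (hM : ∀ x, p x ≤ M)
    (hdim : 3 ≤ finrank ℝ E) (x : E) : p x = p 0 := by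
  -- This is where dimension at least three enters.
  have horth : ∀ i j : E, ∃ k : E, ‖k‖ = 1 ∧ inner ℝ i k = 0 ∧ inner ℝ j k = 0 := by
    intro i j
    classical
    let W := Submodule.span ℝ (({i, j} : Finset E) : Set E)
    have hW : finrank ℝ W ≤ 2 :=
      (finrank_span_finset_le_card (R := ℝ) ({i, j} : Finset E)).trans Finset.card_le_two
    have h2 := Submodule.finrank_add_finrank_orthogonal W
    have h3 : 0 < finrank ℝ Wᗮ := by omega
    obtain ⟨⟨k, hk⟩, hk0⟩ := finrank_pos_iff_exists_ne_zero.1 h3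
    have hk0 : k ≠ 0 := fun h => hk0 (Subtype.ext h)
    refine ⟨‖k‖⁻¹ • k, by simp [norm_smul, hk0], ?_, ?_⟩
    · rw [inner_smul_right, hk i (Submodule.subset_span (by simp)), mul_zero]
    · rw [inner_smul_right, hk j (Submodule.subset_span (by simp)), mul_zero]
  -- `∂ₖ((∂ᵢ∂ⱼp) f)` and `∂ⱼ((∂ᵢ∂ₖp) f)` both equal `∂ᵢ∂ⱼ∂ₖ(p f)`. Cancelling `(∂ᵢ∂ⱼ∂ₖp) f` leaves
  -- `(∂ᵢ∂ⱼp) ∂ₖf = (∂ᵢ∂ₖp) ∂ⱼf`, and pairing with `∂ₖf`, orthogonal to `∂ⱼf`, gives `∂ᵢ∂ⱼp = 0`.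
  have hmix : ∀ i j : E, ‖i‖ = 1 → ‖j‖ = 1 → inner ℝ i j = 0 → dir i (dir j p) = 0 := by
    intro i j hi hj hij
    obtain ⟨k, hk, hik, hjk⟩ := horth i j
    have h1 := congrArg (dir k) (dir_dir_smul_conformal hs hp hp0 hf hi hj hij)
    have h2 := congrArg (dir j) (dir_dir_smul_conformal hs hp hp0 hf hi hk hik)
    have hpf : ContDiff ℝ ∞ (p • f) := hp.smul hs
    rw [dir_smul (contDiff_dir (contDiff_dir hp j) i) hs] at h1
    rw [dir_smul (contDiff_dir (contDiff_dir hp k) i) hs, dir_comm hpf i k,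
      dir_comm (contDiff_dir hpf i) j k, dir_comm hpf j i, h1, dir_comm hp i k,
      dir_comm (contDiff_dir hp i) j k, dir_comm hp j i] at h2
    ext x
    have h3 := congrArg (fun v => inner ℝ v (dir k f x)) (add_left_cancel (congrFun h2 x))
    have hin : ∀ h k, inner ℝ (dir h f x) (dir k f x) = ((p x)⁻¹) ^ 2 * inner ℝ h k := fun h k =>
      inner_map_map_of_norm _ (hf x) h k
    simp only [Pi.smul_apply', inner_smul_left, hin, hjk, real_inner_self_eq_norm_sq, hk] at h3
    have := (hp0 x).ne'
    simpa [this] using h3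
  have hdiag : ∀ i : E, ‖i‖ = 1 → dir i (dir i (dir i p)) = 0 := by
    intro i hi
    obtain ⟨j, hj, hij, -⟩ := horth i i
    have hji : inner ℝ j i = 0 := by rw [real_inner_comm]; exact hij
    have h2 : (√2)⁻¹ ≠ (0:ℝ) := by positivity
    have hn : ∀ ε : ℝ, ε ^ 2 = 1 → ‖(√2)⁻¹ • (i + ε • j)‖ = 1 := by
      intro ε hε
      have : ‖i + ε • j‖ ^ 2 = 2 := by
        rw [norm_add_sq_real, inner_smul_right, hij, norm_smul, hi, hj, mul_pow, Real.norm_eq_abs,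
          sq_abs, hε]
        norm_num
      rw [norm_smul, ← Real.sqrt_sq (norm_nonneg (i + ε • j)), this, norm_inv, Real.norm_eq_abs,
        abs_of_nonneg (Real.sqrt_nonneg 2)]
      exact inv_mul_cancel₀ (by positivity)
    -- The orthonormal pair `(i ± j) / √2` turns the vanishing of mixed derivatives into `∂ᵢ∂ᵢp =
    -- ∂ⱼ∂ⱼp`; then `∂ᵢ∂ᵢ∂ᵢp = ∂ⱼ∂ⱼ∂ᵢp = 0`.
    have h1 := hmix ((√2)⁻¹ • (i + (1:ℝ) • j)) ((√2)⁻¹ • (i + (-1:ℝ) • j)) (hn 1 (by norm_num))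
      (hn (-1) (by norm_num)) (by
        simp only [inner_smul_left, inner_smul_right, inner_add_left, inner_add_right, hij, hji,
          real_inner_self_eq_norm_sq, hi, hj]
        simp)
    have hij0 := hmix i j hi hj hij
    have hji0 := hmix j i hj hi hji
    have h3 : dir i (dir i p) = dir j (dir j p) := by
      ext x
      have h4 := congrFun h1 x
      rw [dir_dir hp] at h4
      have h5 := congrFun hij0 x
      have h6 := congrFun hji0 x
      rw [dir_dir hp] at h5 h6
      rw [dir_dir hp, dir_dir hp]
      simp only [map_smul, map_add, add_apply, smul_apply,
        smul_eq_mul, Pi.zero_apply, mul_eq_zero, h2, false_or] at h4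
      simp only [Pi.zero_apply] at h5 h6
      rw [h5, h6] at h4
      have h7 : (√2)⁻¹ * (fderiv ℝ (fderiv ℝ p) x i i - fderiv ℝ (fderiv ℝ p) x j j) = 0 := by
        linarith
      exact sub_eq_zero.1 ((mul_eq_zero.1 h7).resolve_left h2)
    rw [h3, dir_comm (contDiff_dir hp j), dir_comm hp i j, hji0]
    exact dir_const 0 j
  have hfd : ∀ x, fderiv ℝ p x = 0 := by
    intro x
    ext h
    rcases eq_or_ne h 0 with rfl | hh
    · simp
    have hline : ∀ g : E → ℝ, ContDiff ℝ ∞ g → ∀ (i : E) (t : ℝ),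
        HasDerivAt (fun t : ℝ => g (x + t • i)) (dir i g (x + t • i)) t := by
      intro g hg i t
      have h1 : HasDerivAt (fun t : ℝ => x + t • i) i t := by
        simpa using ((hasDerivAt_id t).smul_const i).const_add x
      exact ((hg.differentiable (by simp) _).hasFDerivAt).comp_hasDerivAt t h1
    let i := ‖h‖⁻¹ • h
    have hi : ‖i‖ = 1 := by simp [i, norm_smul, hh]
    -- On each line `p` is a quadratic polynomial with values in `(0, M]`.
    have h1 := deriv_zero_of_bounded (hline p hp i) (hline _ (contDiff_dir hp i) i)
      (g2 := fun t => dir i (dir i p) (x + t • i)) (M := M) (fun t => by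
        have := hline _ (contDiff_dir (contDiff_dir hp i) i) i t
        rw [hdiag i hi] at this
        exact this) (fun t => by rw [abs_of_pos (hp0 _)]; exact hM _)
    simp only [zero_smul, add_zero] at h1
    have h2 : h = ‖h‖ • i := by simp [i, smul_smul, hh]
    rw [h2, map_smul]
    change ‖h‖ • dir i p x = _
    rw [h1]
    simp
  exact is_const_of_fderiv_eq_zero (𝕜 := ℝ) (hp.differentiable (by simp)) hfd x 0

end Liouville

/-- `hI` is the Cauchy–Riemann equation, so `F` is entire with nonvanishing derivative. Then `1 /
F'` is entire and bounded, as its modulus is `p`, and the classical Liouville theorem applies. -/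
lemma entire_norm_const {F : ℂ → ℂ} {p : ℂ → ℝ} (hF : ContDiff ℝ ∞ F) (hp0 : ∀ z, 0 < p z)
    (h1 : ∀ z, ‖fderiv ℝ F z 1‖ = (p z)⁻¹)
    (hI : ∀ z, fderiv ℝ F z Complex.I = Complex.I * fderiv ℝ F z 1) {M : ℝ} (hM : ∀ z, p z ≤ M)
    (z : ℂ) : p z = p 0 := by
  have hd : ∀ z, HasDerivAt F (fderiv ℝ F z 1) z := by
    intro z
    have hr := ((hF.differentiable (by simp)) z).hasFDerivAt
    have : fderiv ℝ F z = (ContinuousLinearMap.toSpanSingleton ℂ (fderiv ℝ F z 1)).restrictScalars ℝ := by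
      ext w
      have hw : w = w.re • (1 : ℂ) + w.im • Complex.I := by
        apply Complex.ext <;> simp
      conv_lhs => rw [hw, map_add, map_smul, map_smul, hI]
      simp only [ContinuousLinearMap.coe_restrictScalars', ContinuousLinearMap.toSpanSingleton_apply,
        smul_eq_mul, Complex.real_smul]
      conv_rhs => rw [← Complex.re_add_im w]
      ring
    exact (hasFDerivAt_of_restrictScalars ℝ hr this.symm).hasDerivAt.congr_deriv (by simp)
  have hdiff : Differentiable ℂ F := fun z => (hd z).differentiableAt
  have hderiv : deriv F = fun z => fderiv ℝ F z 1 := funext fun z => (hd z).deriv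
  have hne : ∀ z, deriv F z ≠ 0 := fun z => by
    rw [hderiv, ← norm_ne_zero_iff, h1]
    exact (inv_pos.2 (hp0 z)).ne'
  have hinv : Differentiable ℂ fun z => (deriv F z)⁻¹ := fun z =>
    ((hdiff.analyticAt z).deriv.differentiableAt).inv (hne z)
  have hn : ∀ z, ‖(deriv F z)⁻¹‖ = p z := fun z => by
    rw [norm_inv, hderiv, h1, inv_inv]
  have hb : Bornology.IsBounded (Set.range fun z => (deriv F z)⁻¹) := by
    rw [isBounded_iff_forall_norm_le]
    refine ⟨M, ?_⟩
    rintro _ ⟨z, rfl⟩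
    rw [hn]
    exact hM z
  rw [← hn, ← hn, hinv.apply_eq_apply_of_bounded hb z 0]

/-- Entire conformal maps of the plane with scaling factor bounded below. -/
lemma conformal_const_complex {F : ℂ → ℂ} {p : ℂ → ℝ} (hF : ContDiff ℝ ∞ F) (hp0 : ∀ z, 0 < p z)
    (hf : ∀ z h, ‖fderiv ℝ F z h‖ = (p z)⁻¹ * ‖h‖) {M : ℝ} (hM : ∀ z, p z ≤ M)
    (z : ℂ) : p z = p 0 := by
  let q : ℂ → ℂ := fun z => fderiv ℝ F z Complex.I / fderiv ℝ F z 1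
  have h1 : ∀ z, ‖fderiv ℝ F z 1‖ = (p z)⁻¹ := fun z => by rw [hf]; simp
  have hI : ∀ z, ‖fderiv ℝ F z Complex.I‖ = (p z)⁻¹ := fun z => by rw [hf]; simp
  have hne : ∀ z, fderiv ℝ F z 1 ≠ 0 := fun z => by
    rw [← norm_ne_zero_iff, h1]
    exact (inv_pos.2 (hp0 z)).ne'
  have hqc : Continuous q :=
    (((hF.continuous_fderiv (by simp)).clm_apply continuous_const).div
      ((hF.continuous_fderiv (by simp)).clm_apply continuous_const)) hne
  -- The two partial derivatives are orthogonal and of equal length, so their quotient is purely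
  -- imaginary of modulus one. By continuity the sign is the same everywhere: `F` is holomorphic or
  -- antiholomorphic.
  have hq1 : ∀ z, q z = Complex.I ∨ q z = -Complex.I := by
    intro z
    have hin := inner_map_map_of_norm (fderiv ℝ F z) (hf z) 1 Complex.I
    have e1 : inner ℝ (1:ℂ) Complex.I = 0 := by simp [Complex.inner]
    rw [e1, mul_zero] at hin
    have hqz : fderiv ℝ F z Complex.I = q z * fderiv ℝ F z 1 := (div_mul_cancel₀ _ (hne z)).symm
    have hre : (q z).re = 0 := by
      rw [hqz, Complex.inner, mul_assoc, Complex.mul_conj, Complex.re_mul_ofReal] at hin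
      simpa [hne z] using hin
    have hnq : ‖q z‖ = 1 := by
      simp only [q, norm_div, h1, hI]
      exact div_self (inv_pos.2 (hp0 z)).ne'
    have him : (q z).im ^ 2 = 1 := by
      have := Complex.sq_norm (q z)
      rw [hnq, Complex.normSq_apply, hre] at this
      linarith
    rcases mul_self_eq_one_iff.1 ((sq _).symm.trans him) with h | h
    · left; apply Complex.ext <;> simp [hre, h]
    · right; apply Complex.ext <;> simp [hre, h]
  have him : (∀ z, q z = Complex.I) ∨ ∀ z, q z = -Complex.I := by
    by_contra hcon
    push Not at hcon
    obtain ⟨⟨a, ha⟩, b, hb⟩ := hcon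
    have ha' := (hq1 a).resolve_left ha
    have hb' := (hq1 b).resolve_right hb
    have hc : Continuous fun z => (q z).im := Complex.continuous_im.comp hqc
    obtain ⟨c, hc⟩ := mem_range_of_exists_le_of_exists_ge hc (c := 0) ⟨a, by simp [ha']⟩
      ⟨b, by simp [hb']⟩
    rcases hq1 c with h | h <;> simp [h] at hc
  have hqz : ∀ z, fderiv ℝ F z Complex.I = q z * fderiv ℝ F z 1 := fun z =>
    (div_mul_cancel₀ _ (hne z)).symm
  rcases him with h | h
  · exact entire_norm_const hF hp0 h1 (fun z => by rw [hqz, h]) hM z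
  · let G : ℂ → ℂ := fun z => Complex.conjCLE (F z)
    have hG : ContDiff ℝ ∞ G := Complex.conjCLE.contDiff.comp hF
    have hfG : ∀ z w, fderiv ℝ G z w = (starRingEnd ℂ) (fderiv ℝ F z w) := by
      intro z w
      have : HasFDerivAt G _ z := Complex.conjCLE.hasFDerivAt.comp z
        ((hF.differentiable (by simp)) z).hasFDerivAt
      rw [this.fderiv]
      simp
    refine entire_norm_const hG hp0 (fun z => ?_) (fun z => ?_) hM z
    · rw [hfG, RCLike.norm_conj, h1]
    · rw [hfG, hfG, hqz, h]; simp

lemma conformal_const_of_finrank_two {f : Model 2 → Model 2} {p : Model 2 → ℝ}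
    (hs : ContDiff ℝ ∞ f) (hp0 : ∀ x, 0 < p x)
    (hf : ∀ x h, ‖fderiv ℝ f x h‖ = (p x)⁻¹ * ‖h‖) {M : ℝ} (hM : ∀ x, p x ≤ M)
    (x : Model 2) : p x = p 0 := by
  let e : ℂ ≃ₗᵢ[ℝ] Model 2 := Complex.orthonormalBasisOneI.repr
  let F : ℂ → ℂ := fun z => e.symm (f (e z))
  have hF : ContDiff ℝ ∞ F := e.symm.contDiff.comp (hs.comp e.contDiff)
  have hfF : ∀ z h, ‖fderiv ℝ F z h‖ = (p (e z))⁻¹ * ‖h‖ := by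
    intro z h
    have h1 : HasFDerivAt F _ z := (e.symm.toContinuousLinearEquiv.hasFDerivAt).comp z
      (((hs.differentiable (by simp)) (e z)).hasFDerivAt.comp z
        e.toContinuousLinearEquiv.hasFDerivAt)
    rw [h1.fderiv]
    change ‖e.symm (fderiv ℝ f (e z) (e h))‖ = _
    rw [LinearIsometryEquiv.norm_map, hf, LinearIsometryEquiv.norm_map]
  have h1 := conformal_const_complex hF (p := fun z => p (e z)) (fun z => hp0 _) hfF
    (fun z => hM _) (e.symm x)
  simpa using h1

/-! ### The distance law of conformal maps -/

/-- The scaling factor relates the distances of all pairs of points and their images. -/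
def IsMoebiusScale (Φ : Sph n → Sph n) (s : Sph n → ℝ) : Prop :=
  ∀ p q, chord (Φ p) (Φ q) ^ 2 = s p * s q * chord p q ^ 2

/-- Supplies a stereographic chart containing two given points. -/
lemma exists_neg_ne (hn : 1 ≤ n) (p q : Sph n) : ∃ x : Sph n, p ≠ -x ∧ q ≠ -x := by
  have : Nonempty (Fin n) := ⟨⟨0, hn⟩⟩
  have hinf : (Set.range (par p)).Infinite := Set.infinite_range_of_injective (par_injective p)
  obtain ⟨y, -, hy⟩ := hinf.exists_notMem_finset {p, q}
  simp only [Finset.mem_insert, Finset.mem_singleton, not_or] at hy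
  exact ⟨-y, by simpa using Ne.symm hy.1, by simpa using Ne.symm hy.2⟩

/-- Near `x` the quotient is close to its limit; elsewhere its numerator is at most the diameter
`2`. -/
lemma HasScale.bounded_ratio {Φ : Sph n ≃ₘ⟮𝓡 n, 𝓡 n⟯ Sph n} {s : Sph n → ℝ}
    (h : HasScale Φ s) (x : Sph n) : ∃ C, ∀ y, y ≠ x → chord (Φ y) (Φ x) / chord y x ≤ C := by
  have h1 := (h.tendsto x).eventually (Iic_mem_nhds (lt_add_one (s x)))
  rw [eventually_nhdsWithin_iff, Metric.eventually_nhds_iff] at h1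
  obtain ⟨δ, hδ, h1⟩ := h1
  refine ⟨max (s x + 1) (2 / δ), fun y hy => ?_⟩
  by_cases hd : dist y x < δ
  · exact (h1 hd hy).trans (le_max_left _ _)
  · refine le_trans ?_ (le_max_right _ _)
    rw [← chord_eq_dist, not_lt] at hd
    exact div_le_div₀ zero_le_two (chord_le_two _ _) hδ hd

/-- The inverse scaling factor `p` of `chartMap` is bounded even at infinity: `kap (f w) / kap w` is
the squared ratio of distances to the poles, controlled by `HasScale.bounded_ratio`, and `s` has a
positive minimum. Liouville's theorem then makes `p` constant. -/
lemma HasScale.exists_norm_chartMap (hn : 2 ≤ n) {Φ : Sph n ≃ₘ⟮𝓡 n, 𝓡 n⟯ Sph n} {s : Sph n → ℝ}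
    (h : HasScale Φ s) (x : Sph n) : ∃ c, 0 < c ∧
      (∀ w, s (par x w) * kap w = c * kap (chartMap Φ x w)) ∧
      ∀ w w', ‖chartMap Φ x w - chartMap Φ x w'‖ = c * ‖w - w'‖ := by
  set f := chartMap Φ x with hfdef
  have hs : ContDiff ℝ ∞ f := contDiff_chartMap Φ x
  have hsc := h.continuous (by omega)
  let p : Model n → ℝ := fun w => kap (f w) / (s (par x w) * kap w)
  have hp0 : ∀ w, 0 < p w := fun w =>
    div_pos (kap_pos _) (mul_pos (h.pos _) (kap_pos w))
  have hf : ∀ w a, ‖fderiv ℝ f w a‖ = (p w)⁻¹ * ‖a‖ := by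
    intro w a
    rw [h.norm_fderiv_chartMap, inv_div]
  obtain ⟨C, hC⟩ := h.bounded_ratio (-x)
  obtain ⟨y0, -, hy0⟩ := isCompact_univ.exists_isMinOn (s := Set.univ) (f := s)
    ⟨x, trivial⟩ hsc.continuousOn
  have hM : ∀ w, p w ≤ C ^ 2 / s y0 := by
    intro w
    have h1 := hC _ (par_ne_neg x w)
    have h2 : kap (f w) / kap w ≤ C ^ 2 := by
      have e1 := chord_par_neg (-Φ (-x)) (f w)
      rw [par_chartMap, neg_neg] at e1
      have e2 := chord_par_neg x w
      have e3 : kap (f w) / kap w = (chord (Φ (par x w)) (Φ (-x)) / chord (par x w) (-x)) ^ 2 := by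
        rw [div_pow, e1, e2, mul_div_mul_left _ _ (by norm_num)]
      rw [e3]
      exact pow_le_pow_left₀ (div_nonneg (chord_nonneg _ _) (chord_nonneg _ _)) h1 2
    have h3 : s y0 ≤ s (par x w) := hy0 (Set.mem_univ _)
    have h4 : p w = kap (f w) / kap w / s (par x w) := by
      simp only [p]; rw [div_div, mul_comm]
    rw [h4]
    exact div_le_div₀ (sq_nonneg C) h2 (h.pos _) h3
  have hpconst : ∀ w, p w = p 0 := by
    rcases Nat.lt_or_ge 2 n with h3 | h3
    -- `s` is only known to be continuous; smoothness of `p` is read off from the nowhere vanishing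
    -- vector `fderiv ℝ f w e`.
    · have hpc : ContDiff ℝ ∞ p := by
        let e : Model n := EuclideanSpace.single ⟨0, by omega⟩ 1
        have he : ‖e‖ = 1 := by simp [e]
        have : p = fun w => ‖fderiv ℝ f w e‖⁻¹ := by
          ext w; rw [hf, he, mul_one, inv_inv]
        rw [this]
        have h4 : ContDiff ℝ ∞ fun w => fderiv ℝ f w e :=
          (hs.fderiv_right (by simp)).clm_apply contDiff_const
        have h5 : ∀ w, fderiv ℝ f w e ≠ 0 := fun w => by
          rw [← norm_ne_zero_iff, hf, he, mul_one]
          exact (inv_pos.2 (hp0 w)).ne'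
        exact (h4.norm ℝ h5).inv fun w => norm_ne_zero_iff.2 (h5 w)
      exact conformal_const_of_three_le hs hpc hp0 hf hM (by rw [finrank_euclideanSpace_fin]; omega)
    · obtain rfl : n = 2 := by omega
      exact conformal_const_of_finrank_two hs hp0 hf hM
  refine ⟨(p 0)⁻¹, inv_pos.2 (hp0 0), fun w => ?_, fun w w' => ?_⟩
  · rw [← hpconst w]
    have := kap_pos w
    have := kap_pos (f w)
    have := h.pos (par x w)
    simp only [p]
    field_simp
  · exact norm_sub_of_norm_fderiv_const hs (inv_pos.2 (hp0 0))
      (fun z a => by rw [hf, hpconst]) w w'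

lemma HasScale.isMoebiusScale_of_two_le (hn : 2 ≤ n) {Φ : Sph n ≃ₘ⟮𝓡 n, 𝓡 n⟯ Sph n}
    {s : Sph n → ℝ} (h : HasScale Φ s) : IsMoebiusScale Φ s := by
  intro p q
  obtain ⟨x, hp, hq⟩ := exists_neg_ne (by omega) p q
  obtain ⟨c, hc, h1, h2⟩ := h.exists_norm_chartMap hn x
  rw [← par_chart x hp, ← par_chart x hq]
  set w := chartAt (Model n) x p
  set w' := chartAt (Model n) x q
  rw [← par_chartMap, ← par_chartMap, chord_par, chord_par, h2]
  linear_combination (- kap w' * s (par x w') * ‖w - w'‖ ^ 2) * h1 w -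
    (c * kap (chartMap Φ x w) * ‖w - w'‖ ^ 2) * h1 w'

lemma neBot_nhdsNE (hn : 1 ≤ n) (x : Sph n) : (𝓝[≠] x).NeBot := by
  have : Nonempty (Fin n) := ⟨⟨0, hn⟩⟩
  have := (tendsto_par x (0 : Model n)).neBot
  rwa [par_zero] at this

/-- Divide the cross ratio identity by `|p - r|` and let `r → p`, then divide by `|q - t|` and let
`t → q`. Each limit turns a quotient of distances into a value of `s`. -/
lemma HasScale.isMoebiusScale_of_crossRatio (hn : 1 ≤ n) {Φ : Sph n ≃ₘ⟮𝓡 n, 𝓡 n⟯ Sph n}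
    {s : Sph n → ℝ} (h : HasScale Φ s)
    (hcr : ∀ p q r s : Sph n,
      (chord (Φ p) (Φ q) * chord (Φ r) (Φ s)) * (chord p r * chord q s) =
        (chord p q * chord r s) * (chord (Φ p) (Φ r) * chord (Φ q) (Φ s))) :
    IsMoebiusScale Φ s := by
  have hcont : ∀ a : Sph n, Continuous fun r => chord r a := fun a => by
    unfold chord; fun_prop
  have h1 : ∀ p q t, chord (Φ p) (Φ q) * chord (Φ p) (Φ t) * chord q t =
      chord p q * chord p t * (s p * chord (Φ q) (Φ t)) := by
    intro p q t
    have := neBot_nhdsNE hn p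
    have l1 : Tendsto (fun r => chord (Φ p) (Φ q) * chord (Φ r) (Φ t) * chord q t) (𝓝[≠] p)
        (𝓝 (chord (Φ p) (Φ q) * chord (Φ p) (Φ t) * chord q t)) := by
      have hc : Continuous fun r => chord (Φ p) (Φ q) * chord (Φ r) (Φ t) * chord q t :=
        (continuous_const.mul ((hcont (Φ t)).comp Φ.continuous)).mul continuous_const
      exact (hc.tendsto p).mono_left nhdsWithin_le_nhds
    have l2 : Tendsto (fun r => chord p q * chord r t * (chord (Φ r) (Φ p) / chord r p *
        chord (Φ q) (Φ t))) (𝓝[≠] p) (𝓝 (chord p q * chord p t * (s p * chord (Φ q) (Φ t)))) :=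
      (((continuous_const.mul (hcont t)).tendsto p).mono_left nhdsWithin_le_nhds).mul
        ((h.tendsto p).mul_const _)
    refine tendsto_nhds_unique (l1.congr' ?_) l2
    filter_upwards [self_mem_nhdsWithin] with r hr
    have h2 : chord r p ≠ 0 := chord_ne_zero hr
    have h3 := hcr p q r t
    rw [chord_comm p r, chord_comm (Φ p) (Φ r)] at h3
    field_simp
    linarith
  intro p q
  have := neBot_nhdsNE hn q
  have l1 : Tendsto (fun t => chord (Φ p) (Φ q) * chord (Φ t) (Φ p)) (𝓝[≠] q)
      (𝓝 (chord (Φ p) (Φ q) * chord (Φ q) (Φ p))) := by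
    have hc : Continuous fun t => chord (Φ p) (Φ q) * chord (Φ t) (Φ p) :=
      continuous_const.mul ((hcont (Φ p)).comp Φ.continuous)
    exact (hc.tendsto q).mono_left nhdsWithin_le_nhds
  have l2 : Tendsto (fun t => chord p q * chord t p * (s p * (chord (Φ t) (Φ q) / chord t q)))
      (𝓝[≠] q) (𝓝 (chord p q * chord q p * (s p * s q))) :=
    (((continuous_const.mul (hcont p)).tendsto q).mono_left nhdsWithin_le_nhds).mul
      ((h.tendsto q).const_mul _)
  have h2 := tendsto_nhds_unique (l1.congr' ?_) l2
  · rw [chord_comm q p, chord_comm (Φ q) (Φ p)] at h2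
    linarith
  · filter_upwards [self_mem_nhdsWithin] with t ht
    have h2 : chord t q ≠ 0 := chord_ne_zero ht
    have h3 := h1 p q t
    rw [chord_comm q t, chord_comm (Φ q) (Φ t), chord_comm p t, chord_comm (Φ p) (Φ t)] at h3
    field_simp
    linarith

lemma IsConformal.exists_isMoebiusScale (hn : 1 ≤ n) {Φ : Sph n ≃ₘ⟮𝓡 n, 𝓡 n⟯ Sph n}
    (hΦ : IsConformal Φ) : ∃ s, HasScale Φ s ∧ IsMoebiusScale Φ s := by
  obtain ⟨s, hs⟩ := hΦ.exists_hasScale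
  refine ⟨s, hs, ?_⟩
  rcases Nat.lt_or_ge 1 n with h | h
  · exact hs.isMoebiusScale_of_two_le h
  · exact hs.isMoebiusScale_of_crossRatio hn (hΦ.moebius (by omega))

/-! ### Asymptotics of the radial integral -/

section Radial

/-- The radial integrand of a Riesz kernel in stereographic coordinates. -/
def radial (ε : ℝ) (m : ℕ) (r : ℝ) : ℝ :=
  (4 * r ^ 2 / (r ^ 2 + 4)) ^ ε * √(4 / (r ^ 2 + 4)) ^ m / r

lemma measurable_radial (ε : ℝ) (m : ℕ) : Measurable (radial ε m) := by
  unfold radial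
  fun_prop

lemma four_mul_sq_div_le (r : ℝ) : 4 * r ^ 2 / (r ^ 2 + 4) ≤ 4 := by
  rw [div_le_iff₀ (by positivity)]
  linarith

/-- For exponent `2` the integrand has the primitive `(4r² / (r² + 4))^ε / (2ε)`, which exhibits the
exact blow-up rate. Other exponents are compared with this one. -/
lemma radial_two {ε : ℝ} (hε : 0 < ε) :
    IntegrableOn (radial ε 2) (Set.Ioi 0) ∧
      ∫ r in Set.Ioi (0:ℝ), radial ε 2 r = 4 ^ ε / (2 * ε) := by
  let g : ℝ → ℝ := fun r => (4 * r ^ 2 / (r ^ 2 + 4)) ^ ε / (2 * ε)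
  have hbase : Continuous fun r : ℝ => 4 * r ^ 2 / (r ^ 2 + 4) :=
    (by fun_prop : Continuous fun r : ℝ => 4 * r ^ 2).div (by fun_prop) fun r => by positivity
  have hcont : Continuous g := (hbase.rpow_const fun _ => Or.inr hε.le).div_const _
  have hg0 : g 0 = 0 := by simp [g, Real.zero_rpow hε.ne']
  have hderiv : ∀ r ∈ Set.Ioi (0:ℝ), HasDerivAt g (radial ε 2 r) r := by
    intro r hr
    have hr : 0 < r := hr
    have h1 : HasDerivAt (fun r : ℝ => 4 * r ^ 2 / (r ^ 2 + 4)) (32 * r / (r ^ 2 + 4) ^ 2) r := by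
      have := ((hasDerivAt_pow 2 r).const_mul 4).div ((hasDerivAt_pow 2 r).add_const 4)
        (by positivity)
      refine this.congr_deriv ?_
      field_simp
      simp
      ring
    have hpos : 0 < 4 * r ^ 2 / (r ^ 2 + 4) := by positivity
    have h2 := (h1.rpow_const (p := ε) (Or.inl hpos.ne')).div_const (2 * ε)
    refine h2.congr_deriv ?_
    rw [Real.rpow_sub_one hpos.ne', radial, Real.sq_sqrt (by positivity)]
    field_simp
    ring
  have hnn : ∀ r ∈ Set.Ioi (0:ℝ), 0 ≤ radial ε 2 r := by
    intro r hr
    have hr : 0 < r := hr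
    unfold radial
    positivity
  have hlim : Tendsto g atTop (𝓝 (4 ^ ε / (2 * ε))) := by
    have h1 : Tendsto (fun r : ℝ => 4 * r ^ 2 / (r ^ 2 + 4)) atTop (𝓝 4) := by
      have h2 : Tendsto (fun r : ℝ => r ^ 2 + 4) atTop atTop :=
        tendsto_atTop_add_const_right _ _ (tendsto_pow_atTop two_ne_zero)
      have h3 := (h2.inv_tendsto_atTop.const_mul 16).const_sub 4
      rw [mul_zero, sub_zero] at h3
      refine h3.congr fun r => ?_
      have : r ^ 2 + 4 ≠ 0 := by positivity
      simp only [Pi.inv_apply]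
      field_simp
      ring
    exact (h1.rpow_const (Or.inl (by norm_num))).div_const _
  refine ⟨integrableOn_Ioi_deriv_of_nonneg hcont.continuousWithinAt hderiv hnn hlim, ?_⟩
  rw [integral_Ioi_of_hasDerivAt_of_nonneg hcont.continuousWithinAt hderiv hnn hlim, hg0, sub_zero]

/-- The left side vanishes at `t = 0` and `t = 1`; for `m ≥ 2`, Bernoulli's inequality bounds `1 -
t^(m-2)`. -/
lemma abs_pow_sub_sq_le {t : ℝ} (h0 : 0 ≤ t) (h1 : t ≤ 1) {m : ℕ} (hm : 1 ≤ m) :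
    |t ^ m - t ^ 2| ≤ m * (t * (1 - t)) := by
  have ht : 0 ≤ t * (1 - t) := mul_nonneg h0 (sub_nonneg.2 h1)
  rcases Nat.lt_or_ge m 2 with h | h
  · obtain rfl : m = 1 := by omega
    rw [abs_of_nonneg (by nlinarith)]
    simp
    linarith
  · obtain ⟨k, rfl⟩ := Nat.exists_eq_add_of_le h
    have hb := one_add_mul_le_pow (a := t - 1) (by linarith) k
    have hk : t ^ k ≤ 1 := pow_le_one₀ h0 h1
    have e : t ^ (2 + k) - t ^ 2 = -(t ^ 2 * (1 - t ^ k)) := by ring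
    rw [e, abs_neg, abs_of_nonneg (mul_nonneg (sq_nonneg t) (by linarith))]
    have h2 : 1 - t ^ k ≤ k * (1 - t) := by
      have : 1 + (t - 1) = t := by ring
      rw [this] at hb
      linarith
    calc t ^ 2 * (1 - t ^ k) ≤ t ^ 2 * (k * (1 - t)) := by gcongr
      _ = (k * t) * (t * (1 - t)) := by ring
      _ ≤ ((2 + k : ℕ) : ℝ) * (t * (1 - t)) := by
        refine mul_le_mul_of_nonneg_right ?_ ht
        push_cast
        nlinarith [mul_le_mul_of_nonneg_left h1 (Nat.cast_nonneg (α := ℝ) k)]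

/-- At `r = 0` both powers of `t = √(4 / (r² + 4))` equal one, so the `1 / r` singularities cancel.
The bound stays integrable uniformly for small `ε`, and the difference disappears after
multiplication by `ε`. -/
lemma abs_radial_sub_le {ε : ℝ} (hε : 0 < ε) {m : ℕ} (hm : 1 ≤ m) {r : ℝ} (hr : 0 < r) :
    |radial ε m r - radial ε 2 r| ≤ 4 ^ ε * (2 * m) * (1 + r ^ 2)⁻¹ := by
  set t := √(4 / (r ^ 2 + 4)) with ht
  have ht0 : 0 ≤ t := Real.sqrt_nonneg _
  have hts : t ^ 2 = 4 / (r ^ 2 + 4) := Real.sq_sqrt (by positivity)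
  have ht1 : t ≤ 1 := by
    rw [ht, Real.sqrt_le_one, div_le_one (by positivity)]
    nlinarith [sq_nonneg r]
  have htr : t * r ≤ 2 := by
    refine abs_le_of_sq_le_sq' ?_ zero_le_two |>.2
    rw [mul_pow, hts, div_mul_eq_mul_div, div_le_iff₀ (by positivity)]
    nlinarith [sq_nonneg r]
  have e : radial ε m r - radial ε 2 r =
      (4 * r ^ 2 / (r ^ 2 + 4)) ^ ε * ((t ^ m - t ^ 2) / r) := by
    unfold radial
    rw [← ht]
    ring
  have h1 : (4 * r ^ 2 / (r ^ 2 + 4)) ^ ε ≤ 4 ^ ε :=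
    Real.rpow_le_rpow (by positivity) (four_mul_sq_div_le r) hε.le
  have h2 : |(t ^ m - t ^ 2) / r| ≤ 2 * m * (1 + r ^ 2)⁻¹ := by
    rw [abs_div, abs_of_pos hr, div_le_iff₀ hr]
    refine (abs_pow_sub_sq_le ht0 ht1 hm).trans ?_
    have h3 : 1 - t ≤ r ^ 2 / (r ^ 2 + 4) := by
      have : 1 - t ^ 2 = r ^ 2 / (r ^ 2 + 4) := by rw [hts]; field_simp; ring
      rw [← this]
      nlinarith
    have h4 : t * (1 - t) ≤ 2 * (1 + r ^ 2)⁻¹ * r := by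
      calc t * (1 - t) ≤ t * (r ^ 2 / (r ^ 2 + 4)) := by gcongr
        _ = (t * r) * (r / (r ^ 2 + 4)) := by ring
        _ ≤ 2 * (r / (1 + r ^ 2)) := by
          refine mul_le_mul htr (div_le_div_of_nonneg_left hr.le (by positivity) (by linarith))
            (by positivity) zero_le_two
        _ = _ := by ring
    calc (m : ℝ) * (t * (1 - t)) ≤ m * (2 * (1 + r ^ 2)⁻¹ * r) := by gcongr
      _ = _ := by ring
  rw [e, abs_mul, abs_of_nonneg (by positivity), mul_assoc]
  exact mul_le_mul h1 h2 (abs_nonneg _) (by positivity)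

lemma integrableOn_radial {ε : ℝ} (hε : 0 < ε) {m : ℕ} (hm : 1 ≤ m) :
    IntegrableOn (radial ε m) (Set.Ioi 0) := by
  have h1 : IntegrableOn (fun r => radial ε m r - radial ε 2 r) (Set.Ioi 0) := by
    refine Integrable.mono' ((integrable_inv_one_add_sq.const_mul (4 ^ ε * (2 * m))).integrableOn)
      ((measurable_radial ε m).sub (measurable_radial ε 2)).aestronglyMeasurable ?_
    filter_upwards [ae_restrict_mem measurableSet_Ioi] with r hr
    exact abs_radial_sub_le hε hm hr
  have := h1.add (radial_two hε).1
  simpa [Pi.add_def] using this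

lemma tendsto_integral_radial {m : ℕ} (hm : 1 ≤ m) :
    Tendsto (fun ε => ε * ∫ r in Set.Ioi (0:ℝ), radial ε m r) (𝓝[>] 0) (𝓝 (1 / 2)) := by
  let D : ℝ := 2 * m * ∫ r in Set.Ioi (0:ℝ), (1 + r ^ 2)⁻¹
  have hc : Continuous fun ε : ℝ => (4:ℝ) ^ ε := Real.continuous_const_rpow (by norm_num)
  have h1 : Tendsto (fun ε : ℝ => (4:ℝ) ^ ε / 2) (𝓝[>] 0) (𝓝 (1 / 2)) := by
    have := ((hc.tendsto 0).mono_left (nhdsWithin_le_nhds (s := Set.Ioi 0))).div_const 2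
    simpa using this
  have h2 : Tendsto (fun ε : ℝ => ε * 4 ^ ε * D) (𝓝[>] 0) (𝓝 0) := by
    have : Continuous fun ε : ℝ => ε * 4 ^ ε * D := (continuous_id.mul hc).mul continuous_const
    have := (this.tendsto 0).mono_left (nhdsWithin_le_nhds (s := Set.Ioi 0))
    simpa using this
  have h3 : Tendsto (fun ε => ε * (∫ r in Set.Ioi (0:ℝ), radial ε m r) - 4 ^ ε / 2) (𝓝[>] 0)
      (𝓝 0) := by
    refine squeeze_zero_norm' ?_ h2
    filter_upwards [self_mem_nhdsWithin] with ε hε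
    have hε : 0 < ε := hε
    have e : ε * (∫ r in Set.Ioi (0:ℝ), radial ε m r) - 4 ^ ε / 2 =
        ε * ∫ r in Set.Ioi (0:ℝ), (radial ε m r - radial ε 2 r) := by
      rw [integral_sub (integrableOn_radial hε hm) (radial_two hε).1, (radial_two hε).2]
      field_simp
    rw [e, norm_mul, Real.norm_of_nonneg hε.le, mul_assoc]
    refine mul_le_mul_of_nonneg_left ?_ hε.le
    have h4 := norm_integral_le_of_norm_le
      ((integrable_inv_one_add_sq.const_mul (4 ^ ε * (2 * m))).integrableOn (s := Set.Ioi 0))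
      (f := fun r => radial ε m r - radial ε 2 r) (by
        filter_upwards [ae_restrict_mem measurableSet_Ioi] with r hr
        exact abs_radial_sub_le hε hm hr)
    refine h4.trans (le_of_eq ?_)
    rw [integral_const_mul]
    simp only [D]
    ring
  simpa using h3.add h1

end Radial

/-! ### The Riesz kernels as an approximate identity -/

/-- The Riesz kernel of order `2 ε`. -/
def ker (ε : ℝ) (x y : Sph n) : ℝ := chord x y ^ (2 * ε - n)

lemma ker_nonneg (ε : ℝ) (x y : Sph n) : 0 ≤ ker ε x y := Real.rpow_nonneg (chord_nonneg _ _) _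

lemma ker_comm (ε : ℝ) (x y : Sph n) : ker ε x y = ker ε y x := by rw [ker, chord_comm, ker]

lemma measurable_ker (ε : ℝ) : Measurable fun p : Sph n × Sph n => ker ε p.1 p.2 :=
  continuous_chord.measurable.pow_const _

lemma measurableEmbedding_par (x : Sph n) : MeasurableEmbedding (par x) :=
  ((chartAt (Model n) x).symm.isOpenEmbedding (chart_target x)).measurableEmbedding

lemma measurable_kap_pow : Measurable fun w : Model n => ENNReal.ofReal (kap w ^ n) :=
  (continuous_kap.pow n).measurable.ennreal_ofReal

lemma integrable_surf_iff (hn : 1 ≤ n) (x : Sph n) (g : Sph n → ℝ) :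
    Integrable g (surf n) ↔ Integrable fun w => kap w ^ n * g (par x w) := by
  rw [surf_eq_map_par hn x, (measurableEmbedding_par x).integrable_map_iff,
    integrable_withDensity_iff_integrable_smul' measurable_kap_pow (Eventually.of_forall fun _ => ENNReal.ofReal_lt_top)]
  refine integrable_congr (Eventually.of_forall fun w => ?_)
  simp only [Function.comp_apply, smul_eq_mul]
  rw [ENNReal.toReal_ofReal (pow_nonneg (kap_pos w).le _)]

lemma integral_surf (hn : 1 ≤ n) (x : Sph n) (g : Sph n → ℝ) :
    ∫ y, g y ∂(surf n) = ∫ w, kap w ^ n * g (par x w) := by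
  rw [surf_eq_map_par hn x, (measurableEmbedding_par x).integral_map,
    integral_withDensity_eq_integral_toReal_smul measurable_kap_pow (Eventually.of_forall fun _ => ENNReal.ofReal_lt_top)]
  refine integral_congr_ae (Eventually.of_forall fun w => ?_)
  simp only [smul_eq_mul]
  rw [ENNReal.toReal_ofReal (pow_nonneg (kap_pos w).le _)]

/-- The right side is `radial` divided by `r^(n-1)`, the weight of polar coordinates in `ℝ^n`; thus
only `radial` is left to integrate. -/
lemma kap_mul_ker (x : Sph n) (ε : ℝ) {w : Model n} (hw : w ≠ 0) :
    kap w ^ n * ker ε x (par x w) = radial ε n ‖w‖ * ‖w‖ / ‖w‖ ^ n := by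
  have hr : 0 < ‖w‖ := norm_pos_iff.2 hw
  have hk := kap_pos w
  have hd : chord x (par x w) = √(kap w) * ‖w‖ := by
    conv_lhs => rw [← par_zero x, par_zero x]
    have := chord_par_eq x 0 w
    rw [par_zero, kap_zero] at this
    simpa using this
  have hs := Real.sqrt_pos.2 hk
  have e1 : (√(kap w) * ‖w‖) ^ (2 * ε) = (4 * ‖w‖ ^ 2 / (‖w‖ ^ 2 + 4)) ^ ε := by
    rw [Real.rpow_mul (by positivity)]
    congr 1
    rw [Real.rpow_two, mul_pow, Real.sq_sqrt hk.le, kap]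
    ring
  have e2 : kap w ^ n = √(kap w) ^ n * √(kap w) ^ n := by
    rw [← mul_pow, Real.mul_self_sqrt hk.le]
  have e3 : √(4 / (‖w‖ ^ 2 + 4)) = √(kap w) := rfl
  rw [ker, hd, Real.rpow_sub (by positivity), Real.rpow_natCast, e1, e2, radial, e3]
  field_simp
  rw [mul_pow, mul_comm]

/-- The total mass of the Riesz kernel of order `2 ε`. -/
def kerMass (n : ℕ) (ε : ℝ) : ℝ :=
  n * volume.real (ball (0 : Model n) 1) * ∫ r in Set.Ioi (0:ℝ), radial ε n r

lemma integral_ker_aux (hn : 1 ≤ n) (x : Sph n) {ε : ℝ} (hε : 0 < ε) :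
    Integrable (ker ε x) (surf n) ∧ ∫ y, ker ε x y ∂(surf n) = kerMass n ε := by
  have : Nonempty (Fin n) := ⟨⟨0, hn⟩⟩
  have hae : (fun w => kap w ^ n * ker ε x (par x w)) =ᵐ[volume]
      fun w : Model n => (fun r => radial ε n r * r / r ^ n) ‖w‖ := by
    filter_upwards [compl_mem_ae_iff.2 (measure_singleton (0 : Model n))] with w hw
    exact kap_mul_ker x ε hw
  have hpt : ∀ r ∈ Set.Ioi (0:ℝ), r ^ (finrank ℝ (Model n) - 1) • (radial ε n r * r / r ^ n) =
      radial ε n r := by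
    intro r hr
    have hr : 0 < r := hr
    rw [finrank_euclideanSpace_fin, smul_eq_mul]
    obtain ⟨k, rfl⟩ := Nat.exists_eq_add_of_le hn
    rw [Nat.add_sub_cancel_left]
    field_simp
    ring
  constructor
  · rw [integrable_surf_iff hn x, integrable_congr hae, integrable_fun_norm_addHaar volume
      (f := fun r => radial ε n r * r / r ^ n)]
    exact (integrableOn_congr_fun hpt measurableSet_Ioi).2 (integrableOn_radial hε hn)
  · rw [integral_surf hn x, integral_congr_ae hae, integral_fun_norm_addHaar volume
      (fun r => radial ε n r * r / r ^ n), setIntegral_congr_fun measurableSet_Ioi hpt, kerMass,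
      finrank_euclideanSpace_fin, nsmul_eq_mul, smul_eq_mul, mul_assoc]

lemma integrable_ker (hn : 1 ≤ n) (x : Sph n) {ε : ℝ} (hε : 0 < ε) :
    Integrable (ker ε x) (surf n) := (integral_ker_aux hn x hε).1

lemma integral_ker (hn : 1 ≤ n) (x : Sph n) {ε : ℝ} (hε : 0 < ε) :
    ∫ y, ker ε x y ∂(surf n) = kerMass n ε := (integral_ker_aux hn x hε).2

/-- `Cn n` is twice the volume of the unit ball of `ℝ^n`, and the sphere `𝕊^(n-1)` has area `n`
times that volume; the radial integral contributes `1 / 2`. -/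
lemma tendsto_kerMass (hn : 1 ≤ n) :
    Tendsto (fun ε => ε * kerMass n ε) (𝓝[>] 0) (𝓝 (n * Cn n / 4)) := by
  have : Nonempty (Fin n) := ⟨⟨0, hn⟩⟩
  have hn0 : (0:ℝ) < n := by exact_mod_cast hn
  have h1 := (tendsto_integral_radial hn).const_mul (n * volume.real (ball (0 : Model n) 1))
  have h2 : volume.real (ball (0 : Model n) 1) =
      Real.pi ^ ((n:ℝ) / 2) / Real.Gamma (n / 2 + 1) := by
    have h3 : √Real.pi ^ n = Real.pi ^ ((n:ℝ) / 2) := by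
      rw [Real.sqrt_eq_rpow, ← Real.rpow_natCast, ← Real.rpow_mul Real.pi_pos.le]
      congr 1; ring
    have hG : 0 < Real.Gamma ((n:ℝ) / 2 + 1) := Real.Gamma_pos_of_pos (by positivity)
    rw [Measure.real, EuclideanSpace.volume_ball, Fintype.card_fin, h3, ENNReal.ofReal_one,
      one_pow, one_mul, ENNReal.toReal_ofReal (by positivity)]
  have e : n * volume.real (ball (0 : Model n) 1) * (1 / 2) = n * Cn n / 4 := by
    have hG : 0 < Real.Gamma ((n:ℝ) / 2) := Real.Gamma_pos_of_pos (by positivity)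
    rw [h2, Cn, Real.Gamma_add_one (by positivity)]
    field_simp
  rw [e] at h1
  refine h1.congr fun ε => ?_
  rw [kerMass]
  ring

/-- Since distances are at most `2`, the kernels with `ε ≤ 1` are dominated by `4 |ξ - η|^(-n)`. -/
lemma chord_rpow_le {ε : ℝ} (h0 : 0 ≤ ε) (h1 : ε ≤ 1) (x y : Sph n) : chord x y ^ (2 * ε) ≤ 4 :=
  calc chord x y ^ (2 * ε) ≤ 2 ^ (2 * ε) :=
        Real.rpow_le_rpow (chord_nonneg _ _) (chord_le_two _ _) (by linarith)
    _ ≤ 2 ^ (2:ℝ) := Real.rpow_le_rpow_of_exponent_le one_le_two (by linarith)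
    _ = 4 := by norm_num

lemma ker_eq_div {x y : Sph n} (h : x ≠ y) (ε : ℝ) :
    ker ε x y = chord x y ^ (2 * ε) / chord x y ^ n := by
  rw [ker, Real.rpow_sub (chord_pos h), Real.rpow_natCast]

lemma ker_mul_chord_pow_le (hn : 1 ≤ n) {ε : ℝ} (h0 : 0 ≤ ε) (h1 : ε ≤ 1) (x y : Sph n) :
    ker ε x y * chord x y ^ n ≤ 4 := by
  rcases eq_or_ne x y with rfl | h
  · have : chord x x = 0 := by simp [chord]
    rw [this, zero_pow (by omega), mul_zero]
    norm_num
  · rw [ker_eq_div h, div_mul_cancel₀ _ (pow_ne_zero _ (chord_ne_zero h))]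
    exact chord_rpow_le h0 h1 x y

lemma ker_le_div {ε : ℝ} (h0 : 0 ≤ ε) (h1 : ε ≤ 1) {x y : Sph n} (h : x ≠ y) :
    ker ε x y ≤ 4 / chord x y ^ n := by
  rw [ker_eq_div h]
  exact div_le_div_of_nonneg_right (chord_rpow_le h0 h1 x y) (pow_nonneg (chord_nonneg _ _) _)

lemma tendsto_ker {x y : Sph n} (h : x ≠ y) :
    Tendsto (fun ε => ker ε x y) (𝓝[>] 0) (𝓝 (1 / chord x y ^ n)) := by
  have hc : Continuous fun ε : ℝ => chord x y ^ (2 * ε) / chord x y ^ n :=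
    ((Real.continuous_const_rpow (chord_ne_zero h)).comp (continuous_const.mul continuous_id)).div_const _
  have := (hc.tendsto 0).mono_left (nhdsWithin_le_nhds (s := Set.Ioi 0))
  rw [mul_zero, Real.rpow_zero] at this
  exact this.congr fun ε => (ker_eq_div h ε).symm

lemma eventually_small {δ : ℝ} (hδ : 0 < δ) : ∀ᶠ ε : ℝ in 𝓝[>] 0, 0 < ε ∧ ε ≤ δ := by
  filter_upwards [Ioc_mem_nhdsGT hδ] with ε hε using hε

lemma Cn_nonneg (n : ℕ) : 0 ≤ Cn n := by
  unfold Cn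
  rcases Nat.eq_zero_or_pos n with rfl | h
  · simp
  · have : 0 < Real.Gamma ((n:ℝ) / 2) := Real.Gamma_pos_of_pos (by positivity)
    positivity

/-- The rescaled Riesz kernels are an approximate identity. -/
lemma tendsto_integral_ker (hn : 1 ≤ n) {h : Sph n → ℝ} (hc : Continuous h) (x : Sph n) :
    Tendsto (fun ε => ε * ∫ y, ker ε x y * h y ∂(surf n)) (𝓝[>] 0) (𝓝 (n * Cn n / 4 * h x)) := by
  obtain ⟨H, hH⟩ : ∃ H, ∀ y, |h y| ≤ H := by
    obtain ⟨H, hH⟩ := (isCompact_range hc).isBounded.exists_norm_le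
    exact ⟨H, fun y => hH _ ⟨y, rfl⟩⟩
  have hint : ∀ ε > 0, ∀ c : ℝ, Integrable (fun y => ker ε x y * (h y - c)) (surf n) := by
    intro ε hε c
    refine (integrable_ker hn x hε).mul_bdd (c := H + |c|)
      (hc.sub continuous_const).aestronglyMeasurable (Eventually.of_forall fun y => ?_)
    exact (abs_sub _ _).trans (by gcongr; exact hH y)
  have key : Tendsto (fun ε => ε * ∫ y, ker ε x y * (h y - h x) ∂(surf n)) (𝓝[>] 0) (𝓝 0) := by
    rw [Metric.tendsto_nhds]
    intro η' hη'
    set c0 := n * Cn n / 4 with hc0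
    have hc0n : 0 ≤ c0 := by have := Cn_nonneg n; positivity
    set η := η' / (c0 + 1) with hη
    have hηp : 0 < η := by positivity
    obtain ⟨δ, hδ, hδh⟩ := Metric.continuousAt_iff.1 hc.continuousAt η hηp
    -- Continuity handles `y` near `x`. Far away the factor `chord x y ^ n` is at least `δ ^ n`, and
    -- it cancels the singularity of the kernel, so this part stays bounded and is killed by `ε`.
    have hbd : ∀ y, |h y - h x| ≤ η + 2 * H / δ ^ n * chord x y ^ n := by
      intro y
      have hH0 : 0 ≤ H := (abs_nonneg _).trans (hH x)
      by_cases hd : dist y x < δ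
      · have h1 : |h y - h x| < η := hδh hd
        have h2 := chord_nonneg x y
        have : 0 ≤ 2 * H / δ ^ n * chord x y ^ n := by positivity
        linarith
      · rw [not_lt, dist_comm, ← chord_eq_dist] at hd
        have h1 : 2 * H ≤ 2 * H / δ ^ n * chord x y ^ n := by
          rw [div_mul_eq_mul_div, le_div_iff₀ (pow_pos hδ n)]
          gcongr
        have h2 := abs_sub (h y) (h x)
        linarith [hH y, hH x]
    set C := 2 * H / δ ^ n * 4 * (surf n).real Set.univ with hC
    have hlim : Tendsto (fun ε => η * (ε * kerMass n ε) + ε * C) (𝓝[>] 0) (𝓝 (η * c0 + 0 * C)) :=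
      ((tendsto_kerMass hn).const_mul η).add
        ((tendsto_nhdsWithin_of_tendsto_nhds tendsto_id).mul_const C)
    have hlt : η * c0 + 0 * C < η' := by
      rw [zero_mul, add_zero, hη, div_mul_eq_mul_div, div_lt_iff₀ (by positivity)]
      linarith
    filter_upwards [hlim.eventually (gt_mem_nhds hlt), eventually_small one_pos] with ε h1 h2
    obtain ⟨hε, hε1⟩ := h2
    rw [dist_zero_right, norm_mul, Real.norm_of_nonneg hε.le]
    refine lt_of_le_of_lt ?_ h1
    have h3 : ‖∫ y, ker ε x y * (h y - h x) ∂(surf n)‖ ≤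
        ∫ y, (η * ker ε x y + 2 * H / δ ^ n * 4) ∂(surf n) := by
      refine norm_integral_le_of_norm_le (((integrable_ker hn x hε).const_mul η).add
        (integrable_const _)) (Eventually.of_forall fun y => ?_)
      have hH0 : 0 ≤ H := (abs_nonneg _).trans (hH x)
      rw [norm_mul, Real.norm_of_nonneg (ker_nonneg _ _ _)]
      calc ker ε x y * ‖h y - h x‖ ≤ ker ε x y * (η + 2 * H / δ ^ n * chord x y ^ n) :=
            mul_le_mul_of_nonneg_left (hbd y) (ker_nonneg _ _ _)
        _ = η * ker ε x y + 2 * H / δ ^ n * (ker ε x y * chord x y ^ n) := by ring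
        _ ≤ _ := by
          gcongr
          exact ker_mul_chord_pow_le hn hε.le hε1 x y
    rw [integral_add ((integrable_ker hn x hε).const_mul η) (integrable_const _),
      integral_const_mul, integral_ker hn x hε, integral_const, smul_eq_mul] at h3
    calc ε * _ ≤ ε * _ := mul_le_mul_of_nonneg_left h3 hε.le
      _ = _ := by rw [hC]; ring
  have h1 := key.add ((tendsto_kerMass hn).mul_const (h x))
  rw [zero_add] at h1
  refine h1.congr' ?_
  filter_upwards [self_mem_nhdsWithin] with ε hε
  have e : ∀ y, ker ε x y * h y = ker ε x y * (h y - h x) + ker ε x y * h x := fun y => by ring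
  simp_rw [e]
  rw [integral_add (hint ε hε _) ((integrable_ker hn x hε).mul_const _), integral_mul_const,
    integral_ker hn x hε]
  ring

/-! ### The regularized energy -/

section Product

variable {u v : Sph n → ℝ} {ε : ℝ}

lemma integrable_mul_ker_fst (hn : 1 ≤ n) (hε : 0 < ε) {f : Sph n → ℝ}
    (hf : Integrable f (surf n)) :
    Integrable (fun p : Sph n × Sph n => f p.1 * ker ε p.1 p.2) ((surf n).prod (surf n)) := by
  have hm : AEStronglyMeasurable (fun p : Sph n × Sph n => f p.1 * ker ε p.1 p.2)
      ((surf n).prod (surf n)) :=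
    hf.1.comp_fst.mul (measurable_ker ε).aestronglyMeasurable
  rw [integrable_prod_iff hm]
  refine ⟨Eventually.of_forall fun x => (integrable_ker hn x hε).const_mul (f x), ?_⟩
  have e : (fun x => ∫ y, ‖f x * ker ε x y‖ ∂(surf n)) = fun x => ‖f x‖ * kerMass n ε := by
    ext x
    simp_rw [norm_mul, Real.norm_of_nonneg (ker_nonneg _ _ _)]
    rw [integral_const_mul, integral_ker hn x hε]
  rw [e]
  exact hf.norm.mul_const _

lemma integral_mul_ker_fst (hn : 1 ≤ n) (hε : 0 < ε) {f : Sph n → ℝ}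
    (hf : Integrable f (surf n)) :
    ∫ p : Sph n × Sph n, f p.1 * ker ε p.1 p.2 ∂((surf n).prod (surf n)) =
      kerMass n ε * ∫ x, f x ∂(surf n) := by
  rw [integral_prod _ (integrable_mul_ker_fst hn hε hf)]
  simp_rw [integral_const_mul, integral_ker hn _ hε]
  rw [integral_mul_const, mul_comm]

lemma integrable_mul_ker_snd (hn : 1 ≤ n) (hε : 0 < ε) {f : Sph n → ℝ}
    (hf : Integrable f (surf n)) :
    Integrable (fun p : Sph n × Sph n => f p.2 * ker ε p.1 p.2) ((surf n).prod (surf n)) := by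
  refine (integrable_mul_ker_fst hn hε hf).swap.congr (Eventually.of_forall fun p => ?_)
  simp [ker_comm ε p.2 p.1]

lemma integral_mul_ker_snd (hn : 1 ≤ n) (hε : 0 < ε) {f : Sph n → ℝ}
    (hf : Integrable f (surf n)) :
    ∫ p : Sph n × Sph n, f p.2 * ker ε p.1 p.2 ∂((surf n).prod (surf n)) =
      kerMass n ε * ∫ x, f x ∂(surf n) := by
  rw [← integral_mul_ker_fst hn hε hf, ← integral_prod_swap]
  refine integral_congr_ae (Eventually.of_forall fun p => ?_)
  simp [ker_comm ε p.2 p.1]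

lemma integrable_mul_mul_ker (hn : 1 ≤ n) (hε : 0 < ε) (hu : MemLp u 2 (surf n))
    (hv : MemLp v 2 (surf n)) :
    Integrable (fun p : Sph n × Sph n => u p.1 * v p.2 * ker ε p.1 p.2)
      ((surf n).prod (surf n)) := by
  refine Integrable.mono' ((integrable_mul_ker_fst hn hε hu.integrable_sq).add
    (integrable_mul_ker_snd hn hε hv.integrable_sq))
    ((hu.1.comp_fst.mul hv.1.comp_snd).mul (measurable_ker ε).aestronglyMeasurable)
    (Eventually.of_forall fun p => ?_)
  have hk := ker_nonneg ε p.1 p.2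
  simp only [Pi.add_apply]
  rw [norm_mul, Real.norm_of_nonneg hk, ← add_mul, Real.norm_eq_abs]
  refine mul_le_mul_of_nonneg_right ?_ hk
  rw [abs_le]
  constructor <;> nlinarith [sq_nonneg (u p.1 + v p.2), sq_nonneg (u p.1 - v p.2),
    sq_nonneg (u p.1), sq_nonneg (v p.2)]

/-- The energy with the integrable kernel `|ξ - η|^(2ε - n)`. -/
def energyReg (ε : ℝ) (u v : Sph n → ℝ) : ℝ :=
  1 / 2 * ∫ p : Sph n × Sph n, (u p.1 - u p.2) * (v p.1 - v p.2) * ker ε p.1 p.2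
    ∂((surf n).prod (surf n))

lemma integrable_energyReg (hn : 1 ≤ n) (hε : 0 < ε) (hu : MemLp u 2 (surf n))
    (hv : MemLp v 2 (surf n)) :
    Integrable (fun p : Sph n × Sph n => (u p.1 - u p.2) * (v p.1 - v p.2) * ker ε p.1 p.2)
      ((surf n).prod (surf n)) := by
  have huv : Integrable (fun x => u x * v x) (surf n) := hu.integrable_mul hv
  have h := ((integrable_mul_ker_fst hn hε huv).add (integrable_mul_ker_snd hn hε huv)).sub
    ((integrable_mul_mul_ker hn hε hu hv).add (integrable_mul_mul_ker hn hε hv hu))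
  refine h.congr (Eventually.of_forall fun p => ?_)
  simp only [Pi.add_apply, Pi.sub_apply]
  ring

/-- Expand the product: for `ε > 0` all four terms are integrable, and the diagonal ones see only
the constant mass of the kernel. -/
lemma energyReg_eq (hn : 1 ≤ n) (hε : 0 < ε) (hu : MemLp u 2 (surf n))
    (hv : MemLp v 2 (surf n)) :
    energyReg ε u v = kerMass n ε * ∫ x, u x * v x ∂(surf n) -
      ∫ p : Sph n × Sph n, u p.1 * v p.2 * ker ε p.1 p.2 ∂((surf n).prod (surf n)) := by
  have huv : Integrable (fun x => u x * v x) (surf n) := hu.integrable_mul hv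
  have i1 := integrable_mul_ker_fst hn hε huv
  have i2 := integrable_mul_ker_snd hn hε huv
  have i3 := integrable_mul_mul_ker hn hε hu hv
  have i4 := integrable_mul_mul_ker hn hε hv hu
  have e : ∀ p : Sph n × Sph n, (u p.1 - u p.2) * (v p.1 - v p.2) * ker ε p.1 p.2 =
      (u p.1 * v p.1 * ker ε p.1 p.2 + u p.2 * v p.2 * ker ε p.1 p.2) -
      (u p.1 * v p.2 * ker ε p.1 p.2 + v p.1 * u p.2 * ker ε p.1 p.2) := fun p => by ring
  have e2 : ∫ p : Sph n × Sph n, v p.1 * u p.2 * ker ε p.1 p.2 ∂((surf n).prod (surf n)) =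
      ∫ p : Sph n × Sph n, u p.1 * v p.2 * ker ε p.1 p.2 ∂((surf n).prod (surf n)) := by
    rw [← integral_prod_swap]
    refine integral_congr_ae (Eventually.of_forall fun p => ?_)
    simp [ker_comm ε p.2 p.1, mul_comm]
  have i12 : Integrable (fun p : Sph n × Sph n => u p.1 * v p.1 * ker ε p.1 p.2 +
      u p.2 * v p.2 * ker ε p.1 p.2) ((surf n).prod (surf n)) := i1.add i2
  have i34 : Integrable (fun p : Sph n × Sph n => u p.1 * v p.2 * ker ε p.1 p.2 +
      v p.1 * u p.2 * ker ε p.1 p.2) ((surf n).prod (surf n)) := i3.add i4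
  unfold energyReg
  simp_rw [e]
  rw [integral_sub i12 i34, integral_add i1 i2, integral_add i3 i4,
    integral_mul_ker_fst hn hε huv, integral_mul_ker_snd hn hε huv, e2]
  ring

lemma mem_energySpace_iff : u ∈ energySpace n ↔ MemLp u 2 (surf n) ∧
    Integrable (fun p : Sph n × Sph n => (u p.1 - u p.2) ^ 2 / chord p.1 p.2 ^ n)
      ((surf n).prod (surf n)) := by
  refine and_congr_right fun hu => ?_
  have hm : AEStronglyMeasurable (fun p : Sph n × Sph n => (u p.1 - u p.2) ^ 2 / chord p.1 p.2 ^ n)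
      ((surf n).prod (surf n)) :=
    ((hu.1.comp_fst.sub hu.1.comp_snd).pow 2).div₀
      (continuous_chord.pow n).aestronglyMeasurable
  have h0 : ∀ p : Sph n × Sph n, 0 ≤ (u p.1 - u p.2) ^ 2 / chord p.1 p.2 ^ n := fun p =>
    div_nonneg (sq_nonneg _) (pow_nonneg (chord_nonneg _ _) _)
  rw [Integrable, hasFiniteIntegral_iff_ofReal (Eventually.of_forall h0)]
  exact ⟨fun h => ⟨hm, h⟩, fun h => h.2⟩

lemma integrable_energy (hu : u ∈ energySpace n) (hv : v ∈ energySpace n) :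
    Integrable (fun p : Sph n × Sph n =>
      (u p.1 - u p.2) * (v p.1 - v p.2) / chord p.1 p.2 ^ n) ((surf n).prod (surf n)) := by
  obtain ⟨hu1, hu2⟩ := mem_energySpace_iff.1 hu
  obtain ⟨hv1, hv2⟩ := mem_energySpace_iff.1 hv
  refine Integrable.mono' (hu2.add hv2) (((hu1.1.comp_fst.sub hu1.1.comp_snd).mul
    (hv1.1.comp_fst.sub hv1.1.comp_snd)).div₀ (continuous_chord.pow n).aestronglyMeasurable)
    (Eventually.of_forall fun p => ?_)
  have hk : 0 ≤ chord p.1 p.2 ^ n := pow_nonneg (chord_nonneg _ _) _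
  simp only [Pi.add_apply]
  rw [norm_div, Real.norm_of_nonneg hk, ← add_div, Real.norm_eq_abs]
  refine div_le_div_of_nonneg_right ?_ hk
  rw [abs_le]
  constructor <;> nlinarith [sq_nonneg (u p.1 - u p.2 + (v p.1 - v p.2)),
    sq_nonneg (u p.1 - u p.2 - (v p.1 - v p.2)), sq_nonneg (u p.1 - u p.2),
    sq_nonneg (v p.1 - v p.2)]

/-- Integrals against the regularized kernels times bounded weights which converge pointwise. -/
lemma tendsto_integral_ker_mul (hu : u ∈ energySpace n) (hv : v ∈ energySpace n)
    {b : ℝ → Sph n × Sph n → ℝ} {b0 : Sph n × Sph n → ℝ} {C : ℝ}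
    (hbm : ∀ ε, Measurable (b ε)) (hb : ∀ᶠ ε in 𝓝[>] 0, ∀ p, |b ε p| ≤ C)
    (hlim : ∀ p, Tendsto (fun ε => b ε p) (𝓝[>] 0) (𝓝 (b0 p))) :
    Tendsto (fun ε => ∫ p : Sph n × Sph n,
        (u p.1 - u p.2) * (v p.1 - v p.2) * (ker ε p.1 p.2 * b ε p) ∂((surf n).prod (surf n)))
      (𝓝[>] 0) (𝓝 (∫ p : Sph n × Sph n,
        (u p.1 - u p.2) * (v p.1 - v p.2) / chord p.1 p.2 ^ n * b0 p ∂((surf n).prod (surf n)))) := by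
  have hu1 := (mem_energySpace_iff.1 hu).1.1
  have hv1 := (mem_energySpace_iff.1 hv).1.1
  refine tendsto_integral_filter_of_dominated_convergence
    (fun p => 4 * C * ‖(u p.1 - u p.2) * (v p.1 - v p.2) / chord p.1 p.2 ^ n‖) ?_ ?_
    ((integrable_energy hu hv).norm.const_mul _) ?_
  · exact Eventually.of_forall fun ε => ((hu1.comp_fst.sub hu1.comp_snd).mul
      (hv1.comp_fst.sub hv1.comp_snd)).mul
      ((measurable_ker ε).mul (hbm ε)).aestronglyMeasurable
  · filter_upwards [hb, eventually_small one_pos] with ε hbε hε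
    refine Eventually.of_forall fun p => ?_
    rcases eq_or_ne p.1 p.2 with h | h
    · simp [h]
    · have h1 := ker_le_div hε.1.le hε.2 h
      have h2 := ker_nonneg ε p.1 p.2
      have h3 := chord_pos h
      rw [norm_mul, norm_mul (ker ε p.1 p.2), norm_div, Real.norm_of_nonneg h2,
        Real.norm_of_nonneg (pow_nonneg h3.le n)]
      calc _ ≤ ‖(u p.1 - u p.2) * (v p.1 - v p.2)‖ * (4 / chord p.1 p.2 ^ n * C) := by
            gcongr
            exact hbε p
        _ = _ := by ring
  · refine Eventually.of_forall fun p => ?_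
    rcases eq_or_ne p.1 p.2 with h | h
    · simp [h]
    · have h1 := ((tendsto_ker h).mul (hlim p)).const_mul ((u p.1 - u p.2) * (v p.1 - v p.2))
      refine h1.congr' (Eventually.of_forall fun _ => rfl) |>.trans (le_of_eq ?_)
      congr 1
      ring

lemma tendsto_energyReg (hu : u ∈ energySpace n) (hv : v ∈ energySpace n) :
    Tendsto (fun ε => energyReg ε u v) (𝓝[>] 0) (𝓝 (energy u v)) := by
  have h := (tendsto_integral_ker_mul hu hv (b := fun _ _ => 1) (b0 := fun _ => 1) (C := 1)
    (fun _ => measurable_const) (Eventually.of_forall fun _ _ => by simp)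
    (fun _ => tendsto_const_nhds)).const_mul (1 / 2)
  simpa only [mul_one, energyReg, energy] using h

end Product

/-! ### Pullbacks under a conformal map -/

section ChangeOfVariables

variable {Φ : Sph n ≃ₘ⟮𝓡 n, 𝓡 n⟯ Sph n} {s : Sph n → ℝ} {u v : Sph n → ℝ}

/-- The surface measure, weighted by the Jacobian of a map with conformal factor `s`. -/
def scaleMeasure (s : Sph n → ℝ) : Measure (Sph n) :=
  (surf n).withDensity fun x => ENNReal.ofReal (s x ^ n)

lemma HasScale.measurable_density (hn : 1 ≤ n) (h : HasScale Φ s) :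
    Measurable fun x => ENNReal.ofReal (s x ^ n) :=
  ((h.continuous hn).measurable.pow_const n).ennreal_ofReal

lemma isFiniteMeasure_scaleMeasure (hn : 1 ≤ n) (h : HasScale Φ s) :
    IsFiniteMeasure (scaleMeasure s) := by
  refine isFiniteMeasure_withDensity (ne_of_lt ?_)
  have h1 := h.lintegral_comp hn (g := fun _ => 1) measurable_const
  simp only [mul_one, lintegral_one] at h1
  rw [h1]
  exact measure_lt_top _ _

lemma measurableEmbedding_diffeo (Φ : Sph n ≃ₘ⟮𝓡 n, 𝓡 n⟯ Sph n) : MeasurableEmbedding Φ :=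
  Φ.toHomeomorph.measurableEmbedding

lemma HasScale.measurePreserving (hn : 1 ≤ n) (h : HasScale Φ s) :
    MeasurePreserving Φ (scaleMeasure s) (surf n) := by
  refine ⟨Φ.continuous.measurable, Measure.ext_of_lintegral _ fun g hg => ?_⟩
  rw [lintegral_map hg Φ.continuous.measurable, scaleMeasure,
    ← h.lintegral_comp hn hg]
  exact lintegral_withDensity_eq_lintegral_mul _ (h.measurable_density hn)
    (hg.comp Φ.continuous.measurable)

/-- The density `s^n` is positive, so `surf n` and `scaleMeasure s` have the same null sets. -/
lemma HasScale.quasiMeasurePreserving (hn : 1 ≤ n) (h : HasScale Φ s) :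
    Measure.QuasiMeasurePreserving Φ (surf n) (surf n) := by
  refine (h.measurePreserving hn).quasiMeasurePreserving.mono_left ?_
  refine withDensity_absolutelyContinuous' (h.measurable_density hn).aemeasurable
    (Eventually.of_forall fun x => ?_)
  simpa using pow_pos (h.pos x) n

lemma HasScale.integrable_comp_iff (hn : 1 ≤ n) (h : HasScale Φ s) {g : Sph n → ℝ} :
    Integrable (fun x => s x ^ n * g (Φ x)) (surf n) ↔ Integrable g (surf n) := by
  rw [← (h.measurePreserving hn).integrable_comp_emb (measurableEmbedding_diffeo Φ)
    (g := g), scaleMeasure,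
    integrable_withDensity_iff_integrable_smul' (h.measurable_density hn)
      (Eventually.of_forall fun _ => ENNReal.ofReal_lt_top)]
  refine integrable_congr (Eventually.of_forall fun x => ?_)
  simp [ENNReal.toReal_ofReal (pow_nonneg (h.pos x).le n)]

lemma HasScale.integral_comp (hn : 1 ≤ n) (h : HasScale Φ s) (g : Sph n → ℝ) :
    ∫ x, s x ^ n * g (Φ x) ∂(surf n) = ∫ x, g x ∂(surf n) := by
  rw [← (h.measurePreserving hn).integral_comp (measurableEmbedding_diffeo Φ) g,
    scaleMeasure, integral_withDensity_eq_integral_toReal_smul (h.measurable_density hn)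
      (Eventually.of_forall fun _ => ENNReal.ofReal_lt_top)]
  refine integral_congr_ae (Eventually.of_forall fun x => ?_)
  simp [ENNReal.toReal_ofReal (pow_nonneg (h.pos x).le n)]

lemma HasScale.integral_prod_comp (hn : 1 ≤ n) (h : HasScale Φ s) (G : Sph n × Sph n → ℝ) :
    ∫ p : Sph n × Sph n, s p.1 ^ n * s p.2 ^ n * G (Φ p.1, Φ p.2) ∂((surf n).prod (surf n)) =
      ∫ p, G p ∂((surf n).prod (surf n)) := by
  have := isFiniteMeasure_scaleMeasure hn h
  have hm := (h.measurePreserving hn).prod (h.measurePreserving hn)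
  have he := (measurableEmbedding_diffeo Φ).prodMap (measurableEmbedding_diffeo Φ)
  have hd := h.measurable_density hn
  have hd2 : Measurable fun p : Sph n × Sph n =>
      ENNReal.ofReal (s p.1 ^ n) * ENNReal.ofReal (s p.2 ^ n) :=
    (hd.comp measurable_fst).mul (hd.comp measurable_snd)
  rw [← hm.integral_comp he G, scaleMeasure, prod_withDensity hd hd,
    integral_withDensity_eq_integral_toReal_smul hd2
      (Eventually.of_forall fun _ => ENNReal.mul_lt_top ENNReal.ofReal_lt_top ENNReal.ofReal_lt_top)]
  refine integral_congr_ae (Eventually.of_forall fun p => ?_)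
  simp [ENNReal.toReal_ofReal (pow_nonneg (h.pos _).le n), Prod.map]

lemma HasScale.pullback_eq (h : HasScale Φ s) (u : Sph n → ℝ) (x : Sph n) :
    pullback Φ u x = √(s x ^ n) * u (Φ x) := by
  rw [pullback, h.jac_eq]

lemma HasScale.pullback_mul (h : HasScale Φ s) (u v : Sph n → ℝ) (x : Sph n) :
    pullback Φ u x * pullback Φ v x = s x ^ n * (u (Φ x) * v (Φ x)) := by
  rw [h.pullback_eq, h.pullback_eq]
  have := Real.mul_self_sqrt (pow_nonneg (h.pos x).le n)
  linear_combination u (Φ x) * v (Φ x) * this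

lemma HasScale.jac_symm (h : HasScale Φ s) (x : Sph n) :
    jac Φ.symm x = (s (Φ.symm x) ^ n)⁻¹ := by
  rw [h.symm.jac_eq, inv_pow]

lemma HasScale.pullback_symm_eq (h : HasScale Φ s) (u : Sph n → ℝ) (x : Sph n) :
    pullback Φ.symm u (Φ x) = (√(s x ^ n))⁻¹ * u x := by
  rw [pullback, h.jac_symm, Φ.symm_apply_apply, Real.sqrt_inv]

lemma HasScale.pullback_pullback_symm (h : HasScale Φ s) (u : Sph n → ℝ) :
    pullback Φ (pullback Φ.symm u) = u := by
  ext x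
  rw [h.pullback_eq, h.pullback_symm_eq, mul_inv_cancel_left₀]
  exact (Real.sqrt_pos.2 (pow_pos (h.pos x) n)).ne'

lemma HasScale.memLp_pullback (hn : 1 ≤ n) (h : HasScale Φ s) (hu : MemLp u 2 (surf n)) :
    MemLp (pullback Φ u) 2 (surf n) := by
  have hm : AEStronglyMeasurable (pullback Φ u) (surf n) := by
    have h1 : AEStronglyMeasurable (fun x => √(s x ^ n) * u (Φ x)) (surf n) :=
      ((h.continuous hn).pow n).sqrt.aestronglyMeasurable.mul
        (hu.1.comp_quasiMeasurePreserving (h.quasiMeasurePreserving hn))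
    exact h1.congr (Eventually.of_forall fun x => (h.pullback_eq u x).symm)
  rw [memLp_two_iff_integrable_sq hm]
  refine ((h.integrable_comp_iff hn).2 hu.integrable_sq).congr (Eventually.of_forall fun x => ?_)
  have := h.pullback_mul u u x
  simp only
  rw [sq, sq, this]

lemma HasScale.integral_pullback_mul (hn : 1 ≤ n) (h : HasScale Φ s) (u v : Sph n → ℝ) :
    ∫ x, pullback Φ u x * pullback Φ v x ∂(surf n) = ∫ x, u x * v x ∂(surf n) := by
  simp_rw [h.pullback_mul]
  exact h.integral_comp hn fun x => u x * v x

lemma IsMoebiusScale.symm (h : HasScale Φ s) (hm : IsMoebiusScale Φ s) :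
    IsMoebiusScale Φ.symm fun x => (s (Φ.symm x))⁻¹ := by
  intro p q
  have h1 := hm (Φ.symm p) (Φ.symm q)
  rw [Φ.apply_symm_apply, Φ.apply_symm_apply] at h1
  have hp := (h.pos (Φ.symm p)).ne'
  have hq := (h.pos (Φ.symm q)).ne'
  rw [h1]
  field_simp

lemma IsMoebiusScale.ker_comp (h : HasScale Φ s) (hm : IsMoebiusScale Φ s) (ε : ℝ) (x y : Sph n) :
    ker ε (Φ x) (Φ y) = (s x * s y) ^ (ε - n / 2) * ker ε x y := by
  have e : ∀ a b : Sph n, ker ε a b = (chord a b ^ 2) ^ (ε - n / 2) := fun a b => by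
    rw [ker, ← Real.rpow_natCast_mul (chord_nonneg a b)]
    congr 1
    push_cast
    ring
  rw [e, e, hm, Real.mul_rpow (mul_pos (h.pos x) (h.pos y)).le (sq_nonneg _)]

/-- The kernel contributes `(s s)^(ε - n/2)` and the two pullbacks contribute square roots of the
Jacobians. Against the full Jacobian of the substitution only `(s s)^(-ε)` is left over. -/
lemma IsMoebiusScale.integral_pullback_ker (hn : 1 ≤ n) (h : HasScale Φ s)
    (hm : IsMoebiusScale Φ s) (ε : ℝ) (u v : Sph n → ℝ) :
    ∫ p : Sph n × Sph n, pullback Φ u p.1 * pullback Φ v p.2 * ker ε p.1 p.2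
        ∂((surf n).prod (surf n)) =
      ∫ p : Sph n × Sph n, u p.1 * v p.2 *
        (ker ε p.1 p.2 * (s (Φ.symm p.1) * s (Φ.symm p.2)) ^ (-ε)) ∂((surf n).prod (surf n)) := by
  rw [← h.integral_prod_comp hn fun p : Sph n × Sph n => u p.1 * v p.2 *
    (ker ε p.1 p.2 * (s (Φ.symm p.1) * s (Φ.symm p.2)) ^ (-ε))]
  refine integral_congr_ae (Eventually.of_forall fun p => ?_)
  have h1 := h.pos p.1
  have h2 := h.pos p.2
  have h12 := mul_pos h1 h2
  have e1 : (s p.1 * s p.2) ^ (ε - n / 2) * (s p.1 * s p.2) ^ (-ε) * (s p.1 ^ n * s p.2 ^ n) =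
      √(s p.1 ^ n) * √(s p.2 ^ n) := by
    rw [← Real.rpow_add h12, ← mul_pow, ← Real.rpow_natCast, ← Real.rpow_add h12,
      ← Real.sqrt_mul (pow_nonneg h1.le n), ← mul_pow, Real.sqrt_eq_rpow,
      ← Real.rpow_natCast_mul h12.le]
    congr 1
    ring
  simp only [Φ.symm_apply_apply, hm.ker_comp h, h.pullback_eq]
  linear_combination (-(u (Φ p.1) * v (Φ p.2) * ker ε p.1 p.2)) * e1

end ChangeOfVariables

/-! ### The limit of the conformal defect -/

section Anomaly

variable {r : Sph n → ℝ} {G ε : ℝ} {u v : Sph n → ℝ}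

/-- The relative defect of conformal invariance of the kernel `|ξ - η|^(2ε - n)`. -/
def anomaly (r : Sph n → ℝ) (ε : ℝ) (p : Sph n × Sph n) : ℝ := 1 - (r p.1 * r p.2) ^ (-ε)

lemma anomaly_swap (r : Sph n → ℝ) (ε : ℝ) (p : Sph n × Sph n) :
    anomaly r ε p.swap = anomaly r ε p := by
  simp [anomaly, mul_comm]

lemma measurable_anomaly (hc : Continuous r) (ε : ℝ) : Measurable (anomaly r ε) :=
  (((hc.measurable.comp measurable_fst).mul (hc.measurable.comp measurable_snd)).pow_const _).const_sub 1

lemma exists_abs_log_le (hc : Continuous r) (hr : ∀ x, 0 < r x) :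
    ∃ G, 0 < G ∧ ∀ p : Sph n × Sph n, |Real.log (r p.1 * r p.2)| ≤ G := by
  have hcont : Continuous fun p : Sph n × Sph n => Real.log (r p.1 * r p.2) :=
    ((hc.comp continuous_fst).mul (hc.comp continuous_snd)).log
      fun p => (mul_pos (hr p.1) (hr p.2)).ne'
  obtain ⟨G, hG⟩ := (isCompact_range hcont).isBounded.exists_norm_le
  exact ⟨max G 1, lt_max_of_lt_right one_pos, fun p => (hG _ ⟨p, rfl⟩).trans (le_max_left _ _)⟩

lemma abs_anomaly_le (hr : ∀ x, 0 < r x)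
    (hG : ∀ p : Sph n × Sph n, |Real.log (r p.1 * r p.2)| ≤ G)
    (hε : 0 < ε) (hεG : ε * G ≤ 1) (p : Sph n × Sph n) : |anomaly r ε p| ≤ 2 * (ε * G) := by
  have h1 : |Real.log (r p.1 * r p.2) * -ε| ≤ ε * G := by
    rw [abs_mul, abs_neg, abs_of_pos hε, mul_comm]
    exact mul_le_mul_of_nonneg_left (hG p) hε.le
  rw [anomaly, Real.rpow_def_of_pos (mul_pos (hr _) (hr _)), abs_sub_comm]
  linarith [Real.abs_exp_sub_one_le (h1.trans hεG)]

lemma abs_anomaly_sub_le (hr : ∀ x, 0 < r x)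
    (hG : ∀ p : Sph n × Sph n, |Real.log (r p.1 * r p.2)| ≤ G)
    (hε : 0 < ε) (hεG : ε * G ≤ 1) (p : Sph n × Sph n) :
    |anomaly r ε p - ε * Real.log (r p.1 * r p.2)| ≤ (ε * G) ^ 2 := by
  have h1 : |Real.log (r p.1 * r p.2) * -ε| ≤ ε * G := by
    rw [abs_mul, abs_neg, abs_of_pos hε, mul_comm]
    exact mul_le_mul_of_nonneg_left (hG p) hε.le
  have h2 := Real.abs_exp_sub_one_sub_id_le (h1.trans hεG)
  rw [← Real.rpow_def_of_pos (mul_pos (hr _) (hr _)), ← sq_abs (_ * _), abs_sub_comm] at h2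
  refine (le_of_eq ?_).trans (h2.trans (pow_le_pow_left₀ (abs_nonneg _) h1 2))
  rw [anomaly]
  congr 1
  ring

lemma tendsto_anomaly (hr : ∀ x, 0 < r x)
    (p : Sph n × Sph n) : Tendsto (fun ε => anomaly r ε p) (𝓝[>] 0) (𝓝 0) := by
  have hc : Continuous fun ε : ℝ => anomaly r ε p :=
    continuous_const.sub ((Real.continuous_const_rpow (mul_pos (hr _) (hr _)).ne').comp
      continuous_neg)
  have := (hc.tendsto 0).mono_left (nhdsWithin_le_nhds (s := Set.Ioi 0))
  simpa [anomaly] using this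

lemma eventually_mul_le_one (hG : 0 < G) : ∀ᶠ ε : ℝ in 𝓝[>] 0, 0 < ε ∧ ε * G ≤ 1 := by
  filter_upwards [eventually_small (inv_pos.2 hG)] with ε hε
  exact ⟨hε.1, by simpa [hG.ne'] using mul_le_mul_of_nonneg_right hε.2 hG.le⟩

lemma integrable_mul_anomaly (hc : Continuous r) (hr : ∀ x, 0 < r x)
    (hG : ∀ p : Sph n × Sph n, |Real.log (r p.1 * r p.2)| ≤ G) (hε : 0 < ε) (hεG : ε * G ≤ 1)
    {F : Sph n × Sph n → ℝ}
    (hF : Integrable (fun p => F p * ker ε p.1 p.2) ((surf n).prod (surf n))) :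
    Integrable (fun p => F p * (ker ε p.1 p.2 * anomaly r ε p)) ((surf n).prod (surf n)) := by
  simp_rw [← mul_assoc]
  exact hF.mul_bdd (c := 2 * (ε * G)) (measurable_anomaly hc ε).aestronglyMeasurable
    (Eventually.of_forall fun p => abs_anomaly_le hr hG hε hεG p)

/-- Up to `O(ε²)`, negligible against a mass of order `1 / ε`, the defect is `ε log (r x r y)`. The
approximate identity evaluates the logarithm at `y = x`, where `n C_n / 4 · 2 log r` is `C_n log
r^(n/2)`. -/
lemma tendsto_integral_ker_anomaly (hn : 1 ≤ n) (hc : Continuous r) (hr : ∀ x, 0 < r x)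
    (hG0 : 0 < G) (hG : ∀ p : Sph n × Sph n, |Real.log (r p.1 * r p.2)| ≤ G) (x : Sph n) :
    Tendsto (fun ε => ∫ y, ker ε x y * anomaly r ε (x, y) ∂(surf n)) (𝓝[>] 0)
      (𝓝 (Cn n * Real.log (√(r x ^ n)))) := by
  have hlc : Continuous fun y => Real.log (r x * r y) :=
    (continuous_const.mul hc).log fun y => (mul_pos (hr x) (hr y)).ne'
  have hmain := tendsto_integral_ker hn hlc x
  have e : n * Cn n / 4 * Real.log (r x * r x) = Cn n * Real.log (√(r x ^ n)) := by
    rw [Real.log_sqrt (pow_nonneg (hr x).le n), Real.log_pow, Real.log_mul (hr x).ne' (hr x).ne']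
    ring
  rw [e] at hmain
  have herr : Tendsto (fun ε => ∫ y, ker ε x y *
      (anomaly r ε (x, y) - ε * Real.log (r x * r y)) ∂(surf n)) (𝓝[>] 0) (𝓝 0) := by
    have hlim : Tendsto (fun ε => ε * G ^ 2 * (ε * kerMass n ε)) (𝓝[>] 0)
        (𝓝 (0 * G ^ 2 * (n * Cn n / 4))) :=
      ((tendsto_nhdsWithin_of_tendsto_nhds tendsto_id).mul_const _).mul (tendsto_kerMass hn)
    rw [zero_mul, zero_mul] at hlim
    refine squeeze_zero_norm' ?_ hlim
    filter_upwards [eventually_mul_le_one hG0] with ε hε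
    calc _ ≤ ∫ y, ker ε x y * (ε * G) ^ 2 ∂(surf n) := by
          refine norm_integral_le_of_norm_le ((integrable_ker hn x hε.1).mul_const _)
            (Eventually.of_forall fun y => ?_)
          rw [norm_mul, Real.norm_of_nonneg (ker_nonneg _ _ _)]
          exact mul_le_mul_of_nonneg_left (abs_anomaly_sub_le hr hG hε.1 hε.2 (x, y))
            (ker_nonneg _ _ _)
      _ = _ := by
          rw [integral_mul_const, integral_ker hn x hε.1]
          ring
  have hsum := herr.add hmain
  rw [zero_add] at hsum
  refine hsum.congr' ?_
  filter_upwards [eventually_mul_le_one hG0] with ε hε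
  have i0 : Integrable (fun y => ε * (ker ε x y * Real.log (r x * r y))) (surf n) :=
    ((integrable_ker hn x hε.1).mul_bdd (c := G) hlc.aestronglyMeasurable
      (Eventually.of_forall fun y => hG (x, y))).const_mul ε
  have i1 : Integrable (fun y => ker ε x y * (anomaly r ε (x, y) - ε * Real.log (r x * r y)))
      (surf n) := by
    refine (integrable_ker hn x hε.1).mul_bdd (c := (ε * G) ^ 2) ?_
      (Eventually.of_forall fun y => abs_anomaly_sub_le hr hG hε.1 hε.2 (x, y))
    exact (((measurable_anomaly hc ε).comp measurable_prodMk_left).sub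
      (hlc.measurable.const_mul ε)).aestronglyMeasurable
  rw [← integral_const_mul, ← integral_add i1 i0]
  refine integral_congr_ae (Eventually.of_forall fun y => ?_)
  simp only
  ring

/-- Fubini and dominated convergence in `x`: the inner integral is at most `2 G ε kerMass n ε`,
which stays bounded as `ε → 0`. -/
lemma tendsto_integral_fst_mul_anomaly (hn : 1 ≤ n) (hc : Continuous r) (hr : ∀ x, 0 < r x)
    {f : Sph n → ℝ} (hf : Integrable f (surf n)) :
    Tendsto (fun ε => ∫ p : Sph n × Sph n, f p.1 * (ker ε p.1 p.2 * anomaly r ε p)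
        ∂((surf n).prod (surf n))) (𝓝[>] 0)
      (𝓝 (Cn n * ∫ x, f x * Real.log (√(r x ^ n)) ∂(surf n))) := by
  obtain ⟨G, hG0, hG⟩ := exists_abs_log_le hc hr
  set K := n * Cn n / 4 + 1
  have hK : ∀ᶠ ε in 𝓝[>] 0, ε * kerMass n ε < K :=
    (tendsto_kerMass hn).eventually (gt_mem_nhds (lt_add_one _))
  have hlim : Tendsto (fun ε => ∫ x, f x * ∫ y, ker ε x y * anomaly r ε (x, y) ∂(surf n) ∂(surf n))
      (𝓝[>] 0) (𝓝 (∫ x, f x * (Cn n * Real.log (√(r x ^ n))) ∂(surf n))) := by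
    refine tendsto_integral_filter_of_dominated_convergence (fun x => ‖f x‖ * (2 * G * K)) ?_ ?_
      (hf.norm.mul_const _) (Eventually.of_forall fun x =>
        (tendsto_integral_ker_anomaly hn hc hr hG0 hG x).const_mul (f x))
    · refine Eventually.of_forall fun ε => hf.1.mul ?_
      exact (((measurable_ker ε).mul (measurable_anomaly hc ε)).stronglyMeasurable
        |>.integral_prod_right').aestronglyMeasurable
    · filter_upwards [hK, eventually_mul_le_one hG0] with ε h1 h2
      refine Eventually.of_forall fun x => ?_
      rw [norm_mul]
      refine mul_le_mul_of_nonneg_left ?_ (norm_nonneg _)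
      calc _ ≤ ∫ y, ker ε x y * (2 * (ε * G)) ∂(surf n) := by
            refine norm_integral_le_of_norm_le ((integrable_ker hn x h2.1).mul_const _)
              (Eventually.of_forall fun y => ?_)
            rw [norm_mul, Real.norm_of_nonneg (ker_nonneg _ _ _)]
            exact mul_le_mul_of_nonneg_left (abs_anomaly_le hr hG h2.1 h2.2 (x, y))
              (ker_nonneg _ _ _)
        _ = 2 * G * (ε * kerMass n ε) := by
            rw [integral_mul_const, integral_ker hn x h2.1]
            ring
        _ ≤ _ := by gcongr
  have e : ∫ x, f x * (Cn n * Real.log (√(r x ^ n))) ∂(surf n) =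
      Cn n * ∫ x, f x * Real.log (√(r x ^ n)) ∂(surf n) := by
    rw [← integral_const_mul]
    refine integral_congr_ae (Eventually.of_forall fun x => ?_)
    simp only
    ring
  rw [e] at hlim
  refine hlim.congr' ?_
  filter_upwards [eventually_mul_le_one hG0] with ε hε
  rw [integral_prod _ (integrable_mul_anomaly hc hr hG hε.1 hε.2
    (integrable_mul_ker_fst hn hε.1 hf))]
  simp_rw [integral_const_mul]

/-- The functions need not be continuous, so `v(η)` cannot be replaced by `v(ξ)` pointwise. After
symmetrization, `u(ξ) v(η)` differs from `u(ξ) v(ξ)` by `-½ (u(ξ) - u(η)) (v(ξ) - v(η))`. Finite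
energy dominates this term, and the defect tends to zero. -/
lemma tendsto_integral_mul_anomaly (hn : 1 ≤ n) (hc : Continuous r) (hr : ∀ x, 0 < r x)
    (hu : u ∈ energySpace n) (hv : v ∈ energySpace n) :
    Tendsto (fun ε => ∫ p : Sph n × Sph n, u p.1 * v p.2 * (ker ε p.1 p.2 * anomaly r ε p)
        ∂((surf n).prod (surf n))) (𝓝[>] 0)
      (𝓝 (Cn n * ∫ x, u x * v x * Real.log (√(r x ^ n)) ∂(surf n))) := by
  obtain ⟨G, hG0, hG⟩ := exists_abs_log_le hc hr
  have huv : Integrable (fun x => u x * v x) (surf n) := hu.1.integrable_mul hv.1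
  have h1 := tendsto_integral_fst_mul_anomaly hn hc hr huv
  have h2 := tendsto_integral_ker_mul hu hv (b := anomaly r) (b0 := fun _ => 0) (C := 2)
    (measurable_anomaly hc) (by
      filter_upwards [eventually_mul_le_one hG0] with ε hε p
      linarith [abs_anomaly_le hr hG hε.1 hε.2 p]) (tendsto_anomaly hr)
  simp only [mul_zero, integral_zero] at h2
  have h3 := h1.sub (h2.const_mul (1 / 2))
  rw [mul_zero, sub_zero] at h3
  refine h3.congr' ?_
  filter_upwards [eventually_mul_le_one hG0] with ε hε
  have swap : ∀ F : Sph n × Sph n → ℝ,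
      ∫ p, F p.swap * (ker ε p.1 p.2 * anomaly r ε p) ∂((surf n).prod (surf n)) =
        ∫ p, F p * (ker ε p.1 p.2 * anomaly r ε p) ∂((surf n).prod (surf n)) := fun F => by
    rw [← integral_prod_swap]
    refine integral_congr_ae (Eventually.of_forall fun p => ?_)
    simp only [Prod.swap_swap, Prod.fst_swap, Prod.snd_swap, anomaly_swap, ker_comm ε p.2 p.1]
  have i1 := integrable_mul_anomaly hc hr hG hε.1 hε.2 (integrable_mul_ker_fst hn hε.1 huv)
  have i2 := integrable_mul_anomaly hc hr hG hε.1 hε.2 (integrable_mul_ker_snd hn hε.1 huv)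
  have i3 := integrable_mul_anomaly hc hr hG hε.1 hε.2 (integrable_mul_mul_ker hn hε.1 hu.1 hv.1)
  have i4 := integrable_mul_anomaly hc hr hG hε.1 hε.2 (integrable_energyReg hn hε.1 hu.1 hv.1)
  have s1 := swap fun p => u p.1 * v p.1
  have s2 := swap fun p => u p.1 * v p.2
  simp only [Prod.fst_swap, Prod.snd_swap] at s1 s2
  have e : ∫ p : Sph n × Sph n, u p.2 * v p.1 * (ker ε p.1 p.2 * anomaly r ε p)
      ∂((surf n).prod (surf n)) =
      ∫ p : Sph n × Sph n, (u p.1 * v p.1 * (ker ε p.1 p.2 * anomaly r ε p) +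
        u p.2 * v p.2 * (ker ε p.1 p.2 * anomaly r ε p) -
        u p.1 * v p.2 * (ker ε p.1 p.2 * anomaly r ε p) -
        (u p.1 - u p.2) * (v p.1 - v p.2) * (ker ε p.1 p.2 * anomaly r ε p))
      ∂((surf n).prod (surf n)) := by
    refine integral_congr_ae (Eventually.of_forall fun p => ?_)
    simp only
    ring
  have i12 : Integrable (fun p : Sph n × Sph n => u p.1 * v p.1 * (ker ε p.1 p.2 * anomaly r ε p) +
      u p.2 * v p.2 * (ker ε p.1 p.2 * anomaly r ε p)) ((surf n).prod (surf n)) := i1.add i2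
  have i123 : Integrable (fun p : Sph n × Sph n => u p.1 * v p.1 * (ker ε p.1 p.2 * anomaly r ε p) +
      u p.2 * v p.2 * (ker ε p.1 p.2 * anomaly r ε p) -
      u p.1 * v p.2 * (ker ε p.1 p.2 * anomaly r ε p)) ((surf n).prod (surf n)) := i12.sub i3
  rw [integral_sub i123 i4, integral_sub i12 i3, integral_add i1 i2] at e
  linarith

end Anomaly

/-! ### The transformation law and its consequences -/

section Invariance

variable {Φ : Sph n ≃ₘ⟮𝓡 n, 𝓡 n⟯ Sph n} {s : Sph n → ℝ} {u v : Sph n → ℝ}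

lemma IsMoebiusScale.energyReg_pullback (hn : 1 ≤ n) (h : HasScale Φ s) (hm : IsMoebiusScale Φ s)
    (hu : MemLp u 2 (surf n)) (hv : MemLp v 2 (surf n)) :
    ∀ᶠ ε in 𝓝[>] 0, energyReg ε u v + ∫ p : Sph n × Sph n, u p.1 * v p.2 *
      (ker ε p.1 p.2 * anomaly (fun x => s (Φ.symm x)) ε p) ∂((surf n).prod (surf n)) =
        energyReg ε (pullback Φ u) (pullback Φ v) := by
  have hc : Continuous fun x => s (Φ.symm x) := (h.continuous hn).comp Φ.symm.continuous
  obtain ⟨G, hG0, hG⟩ := exists_abs_log_le hc fun _ => h.pos _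
  filter_upwards [eventually_mul_le_one hG0] with ε hε
  have i1 := integrable_mul_mul_ker hn hε.1 hu hv
  have i2 := integrable_mul_anomaly hc (fun x => h.pos _) hG hε.1 hε.2 i1
  rw [energyReg_eq hn hε.1 hu hv, energyReg_eq hn hε.1 (h.memLp_pullback hn hu)
    (h.memLp_pullback hn hv), h.integral_pullback_mul hn, hm.integral_pullback_ker hn h]
  have e : ∫ p : Sph n × Sph n, u p.1 * v p.2 *
        (ker ε p.1 p.2 * (s (Φ.symm p.1) * s (Φ.symm p.2)) ^ (-ε)) ∂((surf n).prod (surf n)) =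
      ∫ p : Sph n × Sph n, (u p.1 * v p.2 * ker ε p.1 p.2 - u p.1 * v p.2 *
        (ker ε p.1 p.2 * anomaly (fun x => s (Φ.symm x)) ε p)) ∂((surf n).prod (surf n)) := by
    refine integral_congr_ae (Eventually.of_forall fun p => ?_)
    simp only [anomaly]
    ring
  rw [e, integral_sub i1 i2]
  ring

lemma IsMoebiusScale.tendsto_energyReg_pullback (hn : 1 ≤ n) (h : HasScale Φ s)
    (hm : IsMoebiusScale Φ s) (hu : u ∈ energySpace n) (hv : v ∈ energySpace n) :
    Tendsto (fun ε => energyReg ε (pullback Φ u) (pullback Φ v)) (𝓝[>] 0)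
      (𝓝 (energy u v + Cn n * ∫ x, u x * v x * Real.log (√(s (Φ.symm x) ^ n)) ∂(surf n))) :=
  ((tendsto_energyReg hu hv).add (tendsto_integral_mul_anomaly hn
    ((h.continuous hn).comp Φ.symm.continuous) (fun _ => h.pos _) hu hv)).congr'
    (hm.energyReg_pullback hn h hu.1 hv.1)

/-- A function with bounded regularized energies has finite energy. -/
lemma mem_energySpace_of_tendsto (hn : 1 ≤ n) (hu : MemLp u 2 (surf n)) {L : ℝ}
    (h : Tendsto (fun ε => energyReg ε u u) (𝓝[>] 0) (𝓝 L)) : u ∈ energySpace n := by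
  refine ⟨hu, ?_⟩
  -- Fatou's lemma is applied along a sequence `ε → 0`.
  obtain ⟨e, he⟩ := exists_seq_tendsto (𝓝[>] (0 : ℝ))
  have hpt : ∀ p : Sph n × Sph n, Tendsto (fun k =>
      ENNReal.ofReal ((u p.1 - u p.2) * (u p.1 - u p.2) * ker (e k) p.1 p.2)) atTop
      (𝓝 (ENNReal.ofReal ((u p.1 - u p.2) ^ 2 / chord p.1 p.2 ^ n))) := by
    intro p
    refine ENNReal.tendsto_ofReal ?_
    rcases eq_or_ne p.1 p.2 with hp | hp
    · simp [hp]
    · have := ((tendsto_ker hp).comp he).const_mul ((u p.1 - u p.2) * (u p.1 - u p.2))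
      simpa only [mul_one_div, ← pow_two, Function.comp_apply] using this
  have hnn : ∀ ε, ∀ p : Sph n × Sph n, 0 ≤ (u p.1 - u p.2) * (u p.1 - u p.2) * ker ε p.1 p.2 :=
    fun ε p => mul_nonneg (mul_self_nonneg _) (ker_nonneg _ _ _)
  have hlim : Tendsto (fun k => ∫⁻ p : Sph n × Sph n,
      ENNReal.ofReal ((u p.1 - u p.2) * (u p.1 - u p.2) * ker (e k) p.1 p.2)
        ∂((surf n).prod (surf n))) atTop (𝓝 (ENNReal.ofReal (2 * L))) := by
    refine (ENNReal.tendsto_ofReal ((h.comp he).const_mul 2)).congr' ?_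
    filter_upwards [he.eventually self_mem_nhdsWithin] with k hk
    rw [← ofReal_integral_eq_lintegral_ofReal (integrable_energyReg hn hk hu hu)
      (Eventually.of_forall (hnn _))]
    congr 1
    simp only [Function.comp_apply, energyReg]
    ring
  calc _ = ∫⁻ p : Sph n × Sph n, liminf (fun k =>
          ENNReal.ofReal ((u p.1 - u p.2) * (u p.1 - u p.2) * ker (e k) p.1 p.2)) atTop
          ∂((surf n).prod (surf n)) := lintegral_congr fun p => (hpt p).liminf_eq.symm
    _ ≤ liminf (fun k => ∫⁻ p : Sph n × Sph n,
          ENNReal.ofReal ((u p.1 - u p.2) * (u p.1 - u p.2) * ker (e k) p.1 p.2)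
          ∂((surf n).prod (surf n))) atTop := by
        refine lintegral_liminf_le' fun k => AEMeasurable.ennreal_ofReal ?_
        exact ((((hu.1.comp_fst.sub hu.1.comp_snd).mul (hu.1.comp_fst.sub hu.1.comp_snd)).mul
          (measurable_ker _).aestronglyMeasurable).aemeasurable)
    _ = ENNReal.ofReal (2 * L) := hlim.liminf_eq
    _ < ⊤ := ENNReal.ofReal_lt_top

/-- The regularized energies of the pullback are defined for any `L²` function, and their
convergence uses finite energy of `u` alone, so there is no circularity. -/
lemma IsMoebiusScale.pullback_mem (hn : 1 ≤ n) (h : HasScale Φ s) (hm : IsMoebiusScale Φ s)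
    (hu : u ∈ energySpace n) : pullback Φ u ∈ energySpace n :=
  mem_energySpace_of_tendsto hn (h.memLp_pullback hn hu.1)
    (hm.tendsto_energyReg_pullback hn h hu hu)

lemma IsMoebiusScale.energy_pullback (hn : 1 ≤ n) (h : HasScale Φ s) (hm : IsMoebiusScale Φ s)
    (hu : u ∈ energySpace n) (hv : v ∈ energySpace n) :
    energy (pullback Φ u) (pullback Φ v) =
      energy u v + Cn n * ∫ x, u x * v x * Real.log (√(s (Φ.symm x) ^ n)) ∂(surf n) :=
  tendsto_nhds_unique (tendsto_energyReg (hm.pullback_mem hn h hu) (hm.pullback_mem hn h hv))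
    (hm.tendsto_energyReg_pullback hn h hu hv)

lemma integrable_mul_log {r : Sph n → ℝ} (hc : Continuous r) (hr : ∀ x, 0 < r x)
    {f : Sph n → ℝ} (hf : Integrable f (surf n)) :
    Integrable (fun x => f x * Real.log (√(r x ^ n))) (surf n) := by
  have hcont : Continuous fun x => Real.log (√(r x ^ n)) :=
    ((hc.pow n).sqrt).log fun x => (Real.sqrt_pos.2 (pow_pos (hr x) n)).ne'
  obtain ⟨G, hG⟩ := (isCompact_range hcont).isBounded.exists_norm_le
  exact hf.mul_bdd (c := G) hcont.aestronglyMeasurable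
    (Eventually.of_forall fun x => hG _ ⟨x, rfl⟩)

/-- Apply the transformation law to `φ_{Φ⁻¹}`, whose pullback is `φ`, and carry the logarithmic
integral back by `Φ`. -/
lemma IsMoebiusScale.energy_pullback_right (hn : 1 ≤ n) (h : HasScale Φ s)
    (hm : IsMoebiusScale Φ s) (hu : u ∈ energySpace n) {φ : Sph n → ℝ} (hφ : φ ∈ energySpace n) :
    energy φ (pullback Φ u) = energy (pullback Φ.symm φ) u +
      Cn n * ∫ x, φ x * (pullback Φ u x * Real.log (√(s x ^ n))) ∂(surf n) := by
  have hψ : pullback Φ.symm φ ∈ energySpace n := (hm.symm h).pullback_mem hn h.symm hφ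
  have h1 := hm.energy_pullback hn h hψ hu
  rw [h.pullback_pullback_symm] at h1
  rw [h1, ← h.integral_comp hn fun x =>
    pullback Φ.symm φ x * u x * Real.log (√(s (Φ.symm x) ^ n))]
  congr 2
  refine integral_congr_ae (Eventually.of_forall fun x => ?_)
  have h2 := h.pullback_mul (pullback Φ.symm φ) u x
  rw [h.pullback_pullback_symm] at h2
  simp only [Φ.symm_apply_apply]
  linear_combination -Real.log (√(s x ^ n)) * h2

lemma HasScale.mul_pullback_mul_log (h : HasScale Φ s) (u φ : Sph n → ℝ) (x : Sph n) :
    φ x * (pullback Φ u x * Real.log (pullback Φ u x)) =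
      φ x * (pullback Φ u x * Real.log (√(s x ^ n))) +
      s x ^ n * (pullback Φ.symm φ (Φ x) * (u (Φ x) * Real.log (u (Φ x)))) := by
  have h2 := h.pullback_mul (pullback Φ.symm φ) u x
  rw [h.pullback_pullback_symm] at h2
  have h3 := h.pullback_eq u x
  -- The logarithm of a product splits only for nonzero factors; where `u` vanishes every term is
  -- zero.
  by_cases h0 : u (Φ x) = 0
  · simp [h3, h0]
  · have h4 : Real.log (pullback Φ u x) = Real.log (√(s x ^ n)) + Real.log (u (Φ x)) := by
      rw [h3, Real.log_mul (Real.sqrt_pos.2 (pow_pos (h.pos x) n)).ne' h0]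
    rw [h4]
    linear_combination Real.log (u (Φ x)) * h2

/-- Splitting `u_Φ log u_Φ` yields the nonlinear term of `u` tested with `φ_{Φ⁻¹}`, plus exactly the
logarithmic term in the transformation law of the energy. -/
lemma IsMoebiusScale.isWeakSolution_pullback (hn : 1 ≤ n) (h : HasScale Φ s)
    (hm : IsMoebiusScale Φ s) (hu : IsWeakSolution u) : IsWeakSolution (pullback Φ u) := by
  have hmem := hm.pullback_mem hn h hu.mem
  have i1 : ∀ φ ∈ energySpace n, Integrable
      (fun x => φ x * (pullback Φ u x * Real.log (√(s x ^ n)))) (surf n) := fun φ hφ => by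
    simp_rw [← mul_assoc]
    exact integrable_mul_log (h.continuous hn) h.pos (hφ.1.integrable_mul hmem.1)
  have i2 : ∀ φ ∈ energySpace n, Integrable
      (fun x => s x ^ n * (pullback Φ.symm φ (Φ x) * (u (Φ x) * Real.log (u (Φ x))))) (surf n) :=
    fun φ hφ => (h.integrable_comp_iff hn).2
      (hu.integrable _ ((hm.symm h).pullback_mem hn h.symm hφ))
  refine ⟨hmem, ?_, fun φ hφ => ?_, fun φ hφ => ?_⟩
  · filter_upwards [(h.quasiMeasurePreserving hn).ae hu.nonneg] with x hx
    rw [h.pullback_eq]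
    exact mul_nonneg (Real.sqrt_nonneg _) hx
  · simp_rw [h.mul_pullback_mul_log]
    exact (i1 φ hφ).add (i2 φ hφ)
  · simp_rw [h.mul_pullback_mul_log]
    rw [integral_add (i1 φ hφ) (i2 φ hφ), hm.energy_pullback_right hn h hu.mem hφ,
      h.integral_comp hn fun x => pullback Φ.symm φ x * (u x * Real.log (u x)),
      hu.eq _ ((hm.symm h).pullback_mem hn h.symm hφ)]
    ring

end Invariance

end ConformalLog

end

open ConformalLog in
theorem lemma2p1 (n : ℕ) (hn : 1 ≤ n)
    (Φ : Sph n ≃ₘ⟮𝓡 n, 𝓡 n⟯ Sph n) (hΦ : IsConformal Φ)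
    (u v : Sph n → ℝ) (hu : u ∈ energySpace n) (hv : v ∈ energySpace n) :
    (pullback Φ u ∈ energySpace n ∧ pullback Φ v ∈ energySpace n) ∧
    (Integrable (fun ξ => u ξ * v ξ * Real.log (1 / √(jac Φ.symm ξ))) (surf n) ∧
      energy (pullback Φ u) (pullback Φ v) =
        energy u v + Cn n * ∫ ξ, u ξ * v ξ * Real.log (1 / √(jac Φ.symm ξ)) ∂(surf n)) ∧
    (∀ φ ∈ energySpace n,
      Integrable (fun ξ => φ ξ * (pullback Φ u ξ * Real.log (√(jac Φ ξ)))) (surf n) ∧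
      weakH (pullback Φ u) φ =
        pullbackWeak Φ (weakH u) φ +
          Cn n * weakFun (fun ξ => pullback Φ u ξ * Real.log (√(jac Φ ξ))) φ) ∧
    (IsWeakSolution u → IsWeakSolution (pullback Φ u)) := by
  obtain ⟨s, h, hm⟩ := hΦ.exists_isMoebiusScale hn
  -- `J_{Φ⁻¹}` is the inverse of `J_Φ ∘ Φ⁻¹`, so the weight of the statement is the `r^(n/2)` of the
  -- limit computation.
  have hlog : ∀ x, Real.log (1 / √(jac Φ.symm x)) = Real.log (√(s (Φ.symm x) ^ n)) := fun x => by
    rw [h.jac_symm, Real.sqrt_inv, one_div, inv_inv]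
  have hmem := hm.pullback_mem hn h hu
  simp_rw [hlog, h.jac_eq]
  refine ⟨⟨hmem, hm.pullback_mem hn h hv⟩, ⟨?_, hm.energy_pullback hn h hu hv⟩,
    fun φ hφ => ⟨?_, hm.energy_pullback_right hn h hu hφ⟩, hm.isWeakSolution_pullback hn h⟩
  · exact integrable_mul_log ((h.continuous hn).comp Φ.symm.continuous)
      (fun x => h.pos _) (hu.1.integrable_mul hv.1)
  · simp_rw [← mul_assoc]
    exact integrable_mul_log (h.continuous hn) h.pos (hφ.1.integrable_mul hmem.1)
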